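/- Let $p\ge 1$ and let $Z,Z_1,Z_2,\dots$ be independent and identically distributed random vectors in $\mathbb{R}^p$ with ${\rm E}\|Z\|_2^8<\infty$, mean $\mu_0={\rm E}(Z)$ and covariance matrix $\Sigma_0={\rm Var}(Z)$. For every sample size $N$ let $k_N$ (subsample size) and $m_N$ (number of subsamples) be positive integers with $k_N\le N$, and let $\mathcal S=\{s^{(1)},\dots,s^{(m_N)}\}$ consist of $m_N$ random subsets drawn independently of each other and of the data, each uniformly distributed on the $\binom{N}{k_N}$ subsets of $\{1,\dots,N\}$ of size $k_N$ (repetitions and overlaps allowed). For a subset $s$ of size $k_N$ put \[ \hat\mu_{k_N,s}=\frac1{k_N}\sum_{i\in s}Z_i,\qquad \hat\Sigma^{(bc)}_{k_N,s}=\frac1{k_N-1}\sum_{i\in s}(Z_i-\hat\mu_{k_N,s})(Z_i-\hat\mu_{k_N,s})^\top , \] and let \[ \hat\mu_{k_N,m_N}=\frac1{m_N}\sum_{s\in\mathcal S}\hat\mu_{k_N,s},\qquad \hat\Sigma^{(bc)}_{k_N,m_N}=\frac1{m_N}\sum_{s\in\mathcal S}\hat\Sigma^{(bc)}_{k_N,s},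 \] \[ \hat\theta^{(bc)}_{k_N,m_N}=\big(\hat\mu_{k_N,m_N}^\top,{\rm vech}^\top(\hat\Sigma^{(bc)}_{k_N,m_N})\big)^\top,\qquad \theta_0=\big(\mu_0^\top,{\rm vech}^\top(\Sigma_0)\big)^\top , \] where ${\rm vech}$ stacks the entries of a $p\times p$ matrix on and below the main diagonal, column by column. Let ${\rm vec}$ be the column-stacking operator, $L_p$ the $p(p+1)/2\times p^2$ elimination matrix (so that $L_p{\rm vec}(A)={\rm vech}(A)$ for all $A$), and \[ K^{(3)}={\rm E}\big[\{(Z-\mu_0)\otimes(Z-\mu_0)\}(Z-\mu_0)^\top\big],\quad K^{(4)}={\rm E}\big[\{(Z-\mu_0)(Z-\mu_0)^\top\}\otimes\{(Z-\mu_0)(Z-\mu_0)^\top\}\big], \] \[ K^{(4)}_L=L_p\{K^{(4)}-{\rm vec}(\Sigma_0){\rm vec}^\top(\Sigma_0)\}L_p^\top,\qquad G=\begin{pmatrix}\Sigma_0&(L_pK^{(3)})^\top\\ L_pK^{(3)}&K^{(4)}_L\end{pmatrix}. \] Assume that $G$ is not singular and that $k_N\to\infty$ and $k_N/N\to0$ as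 $N\to\infty$. Then: (i) If $k_Nm_N/N\to\alpha\in(0,\infty]$, then (with $1/\alpha=0$ for $\alpha=\infty$) \[ \frac{\hat\theta^{(bc)}_{k_N,m_N}-\theta_0}{\sqrt{(1+1/\alpha)/N}}\stackrel{d}{\longrightarrow}\mathcal N(0,G). \] (ii) If $k_Nm_N/N\to0$ and $m_N\to\infty$, then \[ \frac{\hat\theta^{(bc)}_{k_N,m_N}-\theta_0}{\sqrt{1/(k_Nm_N)}}\stackrel{d}{\longrightarrow}\mathcal N(0,G). \] -/

import Mathlib

open MeasureTheory ProbabilityTheory Filter Topology Matrix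
open scoped ENNReal Kronecker

noncomputable section

namespace Subbagging

/-- Index set of the half-vectorization of a `p × p` matrix: pairs (column, row) with
column `≤` row, that is, the positions on and below the main diagonal. Listed lexicographically,
they run through the columns from left to right and down each column. -/
abbrev VechIdx (p : ℕ) : Type := {a : Fin p × Fin p // a.1 ≤ a.2}

/-- Index set of the parameter `(μᵀ, vech(Σ)ᵀ)ᵀ`, of cardinality `p + p (p + 1) / 2`. -/
abbrev ParamIdx (p : ℕ) : Type := Fin p ⊕ VechIdx p

/-- `vech A`: the entries of `A` on and below the main diagonal. -/
def vech {p : ℕ} (A : Matrix (Fin p) (Fin p) ℝ) : VechIdx p → ℝ :=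
  fun q => A q.1.2 q.1.1

/-- The `p (p + 1) / 2 × p ^ 2` elimination matrix `L_p`, which sends `vec A` to `vech A`
(Mathlib's `Matrix.vec` is indexed by (column, row)). -/
def elimMatrix (p : ℕ) : Matrix (VechIdx p) (Fin p × Fin p) ℝ :=
  Matrix.of fun q a => if a = q.1 then 1 else 0

/-- The vector `(vᵀ, vech(A)ᵀ)ᵀ`, in Euclidean space. -/
def stack {p : ℕ} (v : EuclideanSpace ℝ (Fin p)) (A : Matrix (Fin p) (Fin p) ℝ) :
    EuclideanSpace ℝ (ParamIdx p) :=
  WithLp.toLp 2 (Sum.elim (fun i => v i) (vech A))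

section Population

variable {p : ℕ}

/-- Entrywise expectation of a random matrix `M(Z)`, where `Z` has law `F`. -/
def matExp {a b : Type*} (F : Measure (EuclideanSpace ℝ (Fin p)))
    (M : EuclideanSpace ℝ (Fin p) → Matrix a b ℝ) : Matrix a b ℝ :=
  Matrix.of fun i j => ∫ z, M z i j ∂F

/-- The mean vector `μ₀ = E Z`. -/
def mean (F : Measure (EuclideanSpace ℝ (Fin p))) : EuclideanSpace ℝ (Fin p) :=
  ∫ z, z ∂F

/-- The coordinates of `Z - μ₀`. -/
def centred (F : Measure (EuclideanSpace ℝ (Fin p))) (z : EuclideanSpace ℝ (Fin p)) : Fin p → ℝ :=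
  fun i => z i - mean F i

/-- `(Z - μ₀)(Z - μ₀)ᵀ`. -/
def outer (F : Measure (EuclideanSpace ℝ (Fin p))) (z : EuclideanSpace ℝ (Fin p)) :
    Matrix (Fin p) (Fin p) ℝ :=
  vecMulVec (centred F z) (centred F z)

/-- The covariance matrix `Σ₀ = E (Z - μ₀)(Z - μ₀)ᵀ`. -/
def covMat (F : Measure (EuclideanSpace ℝ (Fin p))) : Matrix (Fin p) (Fin p) ℝ :=
  matExp F (outer F)

/-- `K⁽³⁾ = E [{(Z - μ₀) ⊗ (Z - μ₀)} (Z - μ₀)ᵀ]`. -/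
def K3 (F : Measure (EuclideanSpace ℝ (Fin p))) : Matrix (Fin p × Fin p) (Fin p) ℝ :=
  matExp F fun z => vecMulVec (fun a => centred F z a.1 * centred F z a.2) (centred F z)

/-- `K⁽⁴⁾ = E [{(Z - μ₀)(Z - μ₀)ᵀ} ⊗ {(Z - μ₀)(Z - μ₀)ᵀ}]`. -/
def K4 (F : Measure (EuclideanSpace ℝ (Fin p))) :
    Matrix (Fin p × Fin p) (Fin p × Fin p) ℝ :=
  matExp F fun z => outer F z ⊗ₖ outer F z

/-- `K⁽⁴⁾_L = L_p {K⁽⁴⁾ - vec(Σ₀) vec(Σ₀)ᵀ} L_pᵀ`. -/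
def K4L (F : Measure (EuclideanSpace ℝ (Fin p))) : Matrix (VechIdx p) (VechIdx p) ℝ :=
  elimMatrix p * (K4 F - vecMulVec (vec (covMat F)) (vec (covMat F))) * (elimMatrix p)ᵀ

/-- The asymptotic covariance matrix. -/
def asympCov (F : Measure (EuclideanSpace ℝ (Fin p))) : Matrix (ParamIdx p) (ParamIdx p) ℝ :=
  Matrix.fromBlocks (covMat F) (elimMatrix p * K3 F)ᵀ (elimMatrix p * K3 F) (K4L F)

/-- The true parameter `θ₀ = (μ₀ᵀ, vech(Σ₀)ᵀ)ᵀ`. -/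
def trueParam (F : Measure (EuclideanSpace ℝ (Fin p))) : EuclideanSpace ℝ (ParamIdx p) :=
  stack (mean F) (covMat F)

end Population

section Estimators

variable {p : ℕ}

/-- The mean of the data `z` over the subsample `s` of size `k`. -/
def subsampleMean (k : ℕ) (z : ℕ → EuclideanSpace ℝ (Fin p)) (s : Finset ℕ) :
    EuclideanSpace ℝ (Fin p) :=
  (k : ℝ)⁻¹ • ∑ i ∈ s, z i

/-- The bias-corrected (divisor `k - 1`) covariance matrix of the data `z` over the subsample `s`
of size `k`. -/
def subsampleCov (k : ℕ) (z : ℕ → EuclideanSpace ℝ (Fin p)) (s : Finset ℕ) :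
    Matrix (Fin p) (Fin p) ℝ :=
  ((k : ℝ) - 1)⁻¹ • ∑ i ∈ s,
    vecMulVec (fun a => (z i - subsampleMean k z s) a) (fun a => (z i - subsampleMean k z s) a)

/-- The subbagging mean estimator, over `m` subsamples of size `k`. -/
def subbagMean (k m : ℕ) (z : ℕ → EuclideanSpace ℝ (Fin p)) (S : Fin m → Finset ℕ) :
    EuclideanSpace ℝ (Fin p) :=
  (m : ℝ)⁻¹ • ∑ j, subsampleMean k z (S j)

/-- The bias-corrected subbagging covariance matrix estimator, over `m` subsamples of size `k`. -/
def subbagCov (k m : ℕ) (z : ℕ → EuclideanSpace ℝ (Fin p)) (S : Fin m → Finset ℕ) :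
    Matrix (Fin p) (Fin p) ℝ :=
  (m : ℝ)⁻¹ • ∑ j, subsampleCov k z (S j)

/-- The subbagging estimator of `θ₀` based on the two estimators above. -/
def subbagEstimator (k m : ℕ) (z : ℕ → EuclideanSpace ℝ (Fin p)) (S : Fin m → Finset ℕ) :
    EuclideanSpace ℝ (ParamIdx p) :=
  stack (subbagMean k m z S) (subbagCov k m z S)

end Estimators

end Subbagging

end

/-! The divisor `k - 1` turns each subsample covariance into a U-statistic. Recentred at the true
mean, it is the average of the products over single observations minus an average over pairs `i ≠
j`. Averaging over subsamples gives the exact identity `subbagEstimator_sub_trueParam`: the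
estimation error is `∑ i, (inclCount i / (m k)) • influence (Z i)` minus a completely degenerate
double sum. The influence function has mean zero and covariance `asympCov` (`asympCov_apply`).

Leading term. Given the subsamples, this is a sum of independent vectors with fixed weights, so its
characteristic function at `t` is a product of one-dimensional ones. Replacing each factor by a
Gaussian one costs a multiple of the cubed weight. What remains is that the scaled sum of squared
weights tends to 1 in mean and the sum of cubes tends to 0. For a fixed observation, `inclCount` is
a sum of independent Bernoulli(`k / N`) variables, which controls the cubes. The sum of squares
equals `(m k)² ((1 - k/N)/(m k) + 1/N)` plus a double sum over pairs of subsamples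
(`sum_inclCount_sq_eq`). This sum is again degenerate, now with respect to the randomness of the
subsamples, and hence negligible. The two variance contributions `1/(m k)` and `1/N` come from the
drawing of subsamples and from the data. Everything is collected in
`norm_integral_exp_sum_inclCount_sub_le`.

Remainder. Given the subsamples, it is degenerate in the data. The bound
`integral_sq_sum_offDiag_le`, which also serves for the pairs of subsamples, gives a second moment
of order `1/(m k²) + 1/N²`, smaller than the variance of the leading term
(`lintegral_norm_sq_remainder_le`).

Both regimes are therefore one theorem, `tendstoInDistribution_smul_subbagEstimator_sub`, for any
rate `r` with `r² (1/(m k) + 1/N) → 1`. They correspond to `r² = N / (1 + 1/α)` and `r² = k m`. -/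

namespace Subbagging

/-! ### Elementary estimates for characteristic functions -/

section Analysis

/-- Telescoping: exchange one factor at a time, all the others having norm at most 1. This is the
Lindeberg replacement on the level of characteristic functions. -/
lemma norm_prod_sub_prod_le_sum {ι : Type*} (s : Finset ι) (f g : ι → ℂ)
    (hf : ∀ i ∈ s, ‖f i‖ ≤ 1) (hg : ∀ i ∈ s, ‖g i‖ ≤ 1) :
    ‖∏ i ∈ s, f i - ∏ i ∈ s, g i‖ ≤ ∑ i ∈ s, ‖f i - g i‖ := by
  classical
  induction s using Finset.induction_on with
  | empty => simp
  | insert a s ha ih =>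
    rw [Finset.prod_insert ha, Finset.prod_insert ha, Finset.sum_insert ha]
    have h1 : f a * ∏ i ∈ s, f i - g a * ∏ i ∈ s, g i
        = (f a - g a) * ∏ i ∈ s, f i + g a * (∏ i ∈ s, f i - ∏ i ∈ s, g i) := by ring
    rw [h1]
    have h2 : ‖∏ i ∈ s, f i‖ ≤ 1 := by
      rw [norm_prod]
      exact Finset.prod_le_one (fun i _ => norm_nonneg _)
        (fun i hi => hf i (Finset.mem_insert_of_mem hi))
    have h3 := ih (fun i hi => hf i (Finset.mem_insert_of_mem hi))
      (fun i hi => hg i (Finset.mem_insert_of_mem hi))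
    have h4 := hg a (Finset.mem_insert_self _ _)
    refine (norm_add_le _ _).trans (add_le_add ?_ ?_)
    · rw [norm_mul]
      exact mul_le_of_le_one_right (norm_nonneg _) h2
    · rw [norm_mul]
      exact (mul_le_of_le_one_left (norm_nonneg _) h4).trans h3

lemma norm_exp_mul_I_sub_taylor_le (x : ℝ) :
    ‖Complex.exp (x * Complex.I) - 1 - x * Complex.I + (x : ℂ) ^ 2 / 2‖ ≤ 4 * |x| ^ 3 := by
  rcases le_total |x| 1 with hx | hx
  · have hn : ‖(x * Complex.I : ℂ)‖ = |x| := by simp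
    have h := Complex.exp_bound (x := x * Complex.I) (by rw [hn]; exact hx) (n := 3) (by norm_num)
    rw [hn] at h
    have e : Complex.exp (x * Complex.I)
          - ∑ m ∈ Finset.range 3, (x * Complex.I) ^ m / (m.factorial : ℂ)
        = Complex.exp (x * Complex.I) - 1 - x * Complex.I + (x : ℂ) ^ 2 / 2 := by
      simp only [Finset.sum_range_succ, Finset.sum_range_zero, Nat.factorial, mul_pow,
        Complex.I_sq]
      push_cast
      ring
    rw [e] at h
    refine h.trans ?_
    rw [mul_comm]
    gcongr
    norm_num [Nat.factorial]
  · have h1 : ‖Complex.exp (x * Complex.I)‖ = 1 := Complex.norm_exp_ofReal_mul_I x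
    have h2 : ‖(x * Complex.I : ℂ)‖ = |x| := by simp
    have h3 : ‖(x : ℂ) ^ 2 / 2‖ = |x| ^ 2 / 2 := by simp
    calc _ ≤ ‖Complex.exp (x * Complex.I)‖ + ‖(1 : ℂ)‖ + ‖(x * Complex.I : ℂ)‖
          + ‖(x : ℂ) ^ 2 / 2‖ :=
          (norm_add_le _ _).trans (add_le_add ((norm_sub_le _ _).trans
            (add_le_add (norm_sub_le _ _) le_rfl)) le_rfl)
      _ = 2 + |x| + |x| ^ 2 / 2 := by rw [h1, h2, h3, norm_one]; ring
      _ ≤ _ := by nlinarith [pow_le_pow_right₀ hx (show 1 ≤ 3 by norm_num),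
          pow_le_pow_right₀ hx (show 2 ≤ 3 by norm_num), one_le_pow₀ hx (n := 3)]

/-- The error is of fourth order near 0 and at most quadratic far away. The cubic bound dominates
both, so it holds globally and can be added to the third-order Taylor error of the characteristic
function. -/
lemma abs_exp_neg_sq_sub_le {y : ℝ} (hy : 0 ≤ y) :
    |Real.exp (-y ^ 2) - 1 + y ^ 2| ≤ y ^ 3 := by
  have h0 : 0 ≤ Real.exp (-y ^ 2) - 1 + y ^ 2 := by
    linarith [Real.add_one_le_exp (-y ^ 2)]
  rw [abs_of_nonneg h0]
  rcases le_total y 1 with h | h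
  · have h1 : |(-y ^ 2)| ≤ 1 := by
      rw [abs_neg, abs_of_nonneg (by positivity)]
      exact pow_le_one₀ hy h
    have h2 := Real.abs_exp_sub_one_sub_id_le h1
    have h3 := (abs_le.1 h2).2
    have h4 : (-y ^ 2) ^ 2 ≤ y ^ 3 := by
      have : (-y ^ 2) ^ 2 = y ^ 3 * y := by ring
      rw [this]
      exact mul_le_of_le_one_right (by positivity) h
    linarith
  · have h1 : Real.exp (-y ^ 2) ≤ 1 := Real.exp_le_one_iff.2 (by nlinarith)
    have h2 : y ^ 2 ≤ y ^ 3 := pow_le_pow_right₀ h (by norm_num)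
    linarith

lemma abs_exp_neg_sub_exp_neg_le {a b : ℝ} (ha : 0 ≤ a) (hb : 0 ≤ b) :
    |Real.exp (-a) - Real.exp (-b)| ≤ |a - b| := by
  wlog h : a ≤ b generalizing a b
  · rw [abs_sub_comm, abs_sub_comm a b]
    exact this hb ha (le_of_not_ge h)
  have h1 : Real.exp (-b) ≤ Real.exp (-a) := Real.exp_le_exp.2 (by linarith)
  rw [abs_of_nonneg (by linarith), abs_of_nonpos (by linarith)]
  have h2 : Real.exp (-b) = Real.exp (-a) * Real.exp (-(b - a)) := by
    rw [← Real.exp_add]; congr 1; ring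
  have h3 : Real.exp (-a) ≤ 1 := Real.exp_le_one_iff.2 (by linarith)
  have h4 := Real.add_one_le_exp (-(b - a))
  have h5 := Real.exp_pos (-a)
  rw [h2]
  nlinarith

/-- Third-order comparison of a centred characteristic function with the Gaussian one. -/
lemma exists_norm_charFun_sub_exp_le (μ : Measure ℝ) [IsProbabilityMeasure μ]
    (h3 : MemLp id 3 μ) (h0 : ∫ x, x ∂μ = 0) :
    ∃ C : ℝ, 0 ≤ C ∧ ∀ t : ℝ,
      ‖charFun μ t - (Real.exp (-((∫ x, x ^ 2 ∂μ) / 2 * t ^ 2)) : ℝ)‖ ≤ C * |t| ^ 3 := by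
  set q := ∫ x, x ^ 2 ∂μ with hq
  have hq0 : 0 ≤ q := integral_nonneg fun x => sq_nonneg x
  have hi1 : Integrable (fun x : ℝ => x) μ := (h3.mono_exponent (by norm_num)).integrable le_rfl
  have hi2 : Integrable (fun x : ℝ => x ^ 2) μ :=
    (h3.mono_exponent (q := 3) (p := 2) (by norm_num)).integrable_sq
  have hi3 : Integrable (fun x : ℝ => |x| ^ 3) μ := by
    have := h3.integrable_norm_pow (by norm_num)
    simpa using this
  -- Both functions are compared with `1 - q t² / 2`. The first summand is the Taylor error of
  -- `charFun μ`, the second that of the Gaussian, obtained with `y = √(q / 2) * |t|`.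
  refine ⟨4 * (∫ x, |x| ^ 3 ∂μ) + √(q / 2) ^ 3, by positivity, fun t => ?_⟩
  have hexp : Integrable (fun x : ℝ => Complex.exp (t * x * Complex.I)) μ := by
    refine Integrable.of_bound (C := 1) (by fun_prop) (.of_forall fun x => ?_)
    rw [← Complex.ofReal_mul, Complex.norm_exp_ofReal_mul_I]
  have hlin : Integrable (fun x : ℝ => (t * x * Complex.I : ℂ)) μ := by
    have := (hi1.ofReal (𝕜 := ℂ)).const_mul (t : ℂ) |>.mul_const Complex.I
    simpa using this
  have hquad : Integrable (fun x : ℝ => ((t * x : ℂ)) ^ 2 / 2) μ := by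
    have := (hi2.ofReal (𝕜 := ℂ)).const_mul ((t : ℂ) ^ 2) |>.div_const 2
    simpa [mul_pow] using this
  have h1 : ‖charFun μ t - 1 + (q : ℂ) * t ^ 2 / 2‖ ≤ 4 * (∫ x, |x| ^ 3 ∂μ) * |t| ^ 3 := by
    have e : charFun μ t - 1 + (q : ℂ) * t ^ 2 / 2
        = ∫ x : ℝ, (Complex.exp (t * x * Complex.I) - 1 - t * x * Complex.I
            + ((t * x : ℂ)) ^ 2 / 2) ∂μ := by
      have hc : Integrable (fun x : ℝ => Complex.exp (t * x * Complex.I) - 1) μ :=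
        hexp.sub (integrable_const _)
      have hcl : Integrable (fun x : ℝ => Complex.exp (t * x * Complex.I) - 1
          - t * x * Complex.I) μ := hc.sub hlin
      rw [integral_add hcl hquad, integral_sub hc hlin,
        integral_sub hexp (integrable_const _), charFun_apply_real]
      have e1 : ∫ x : ℝ, (t * x * Complex.I : ℂ) ∂μ = 0 := by
        rw [integral_mul_const, integral_const_mul, integral_complex_ofReal, h0]
        simp
      have e2 : ∫ x : ℝ, ((t * x : ℂ)) ^ 2 / 2 ∂μ = (q : ℂ) * t ^ 2 / 2 := by
        have : (fun x : ℝ => ((t * x : ℂ)) ^ 2 / 2)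
            = fun x : ℝ => ((t : ℂ) ^ 2 / 2) * ((x ^ 2 : ℝ) : ℂ) := by
          ext x; push_cast; ring
        rw [this, integral_const_mul, integral_complex_ofReal, ← hq]
        ring
      rw [e1, e2]
      simp
    rw [e]
    refine (norm_integral_le_integral_norm _).trans ?_
    rw [← integral_const_mul, ← integral_mul_const]
    refine integral_mono_of_nonneg (.of_forall fun x => norm_nonneg _)
      ((hi3.const_mul _).mul_const _) (.of_forall fun x => ?_)
    have := norm_exp_mul_I_sub_taylor_le (t * x)
    push_cast at this
    refine this.trans (le_of_eq ?_)
    rw [abs_mul]; ring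
  have h2 : |Real.exp (-(q / 2 * t ^ 2)) - 1 + q / 2 * t ^ 2| ≤ √(q / 2) ^ 3 * |t| ^ 3 := by
    have := abs_exp_neg_sq_sub_le (y := √(q / 2) * |t|) (by positivity)
    rwa [mul_pow, mul_pow, Real.sq_sqrt (by positivity), sq_abs] at this
  have e : charFun μ t - (Real.exp (-(q / 2 * t ^ 2)) : ℝ)
      = (charFun μ t - 1 + (q : ℂ) * t ^ 2 / 2)
        - ((Real.exp (-(q / 2 * t ^ 2)) - 1 + q / 2 * t ^ 2 : ℝ) : ℂ) := by
    push_cast; ring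
  rw [e, add_mul]
  refine (norm_sub_le _ _).trans (add_le_add h1 ?_)
  rw [Complex.norm_real]
  exact h2

end Analysis

/-! ### Fubini for independent variables and degenerate double sums -/

section Independence

variable {Ω α β : Type*} [MeasurableSpace Ω] [MeasurableSpace α] [MeasurableSpace β]
  {P : Measure Ω} [IsProbabilityMeasure P]

/-- Integrate out two independent variables one after the other. -/
lemma integral_comp_prodMk_of_indepFun {E : Type*} [NormedAddCommGroup E] [NormedSpace ℝ E]
    {X : Ω → α} {Y : Ω → β} (hXY : IndepFun X Y P)
    (hX : AEMeasurable X P) (hY : AEMeasurable Y P) {f : α × β → E} (hf : StronglyMeasurable f)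
    (hint : Integrable (fun ω => f (X ω, Y ω)) P) :
    ∫ ω, f (X ω, Y ω) ∂P = ∫ ω, ∫ ω', f (X ω', Y ω) ∂P ∂P := by
  have hmap := (indepFun_iff_map_prod_eq_prod_map_map hX hY).1 hXY
  have : IsProbabilityMeasure (P.map X) := Measure.isProbabilityMeasure_map hX
  have : IsProbabilityMeasure (P.map Y) := Measure.isProbabilityMeasure_map hY
  have hint' : Integrable f ((P.map X).prod (P.map Y)) := by
    rw [← hmap, integrable_map_measure hf.aestronglyMeasurable (hX.prodMk hY)]
    exact hint
  calc ∫ ω, f (X ω, Y ω) ∂P = ∫ z, f z ∂(P.map fun ω => (X ω, Y ω)) :=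
        (integral_map (hX.prodMk hY) hf.aestronglyMeasurable).symm
    _ = ∫ y, ∫ x, f (x, y) ∂(P.map X) ∂(P.map Y) := by
        rw [hmap, integral_prod_symm _ hint']
    _ = ∫ ω, ∫ x, f (x, Y ω) ∂(P.map X) ∂P :=
        integral_map hY hint'.swap.integral_prod_left.aestronglyMeasurable
    _ = _ := by
        congr with ω
        exact integral_map hX
          (hf.comp_measurable measurable_prodMk_right).aestronglyMeasurable

lemma lintegral_comp_prodMk_of_indepFun {X : Ω → α} {Y : Ω → β} (hXY : IndepFun X Y P)
    (hX : AEMeasurable X P) (hY : AEMeasurable Y P) {f : α × β → ℝ≥0∞} (hf : Measurable f) :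
    ∫⁻ ω, f (X ω, Y ω) ∂P = ∫⁻ ω, ∫⁻ ω', f (X ω', Y ω) ∂P ∂P := by
  have hmap := (indepFun_iff_map_prod_eq_prod_map_map hX hY).1 hXY
  have : IsProbabilityMeasure (P.map X) := Measure.isProbabilityMeasure_map hX
  have : IsProbabilityMeasure (P.map Y) := Measure.isProbabilityMeasure_map hY
  calc ∫⁻ ω, f (X ω, Y ω) ∂P = ∫⁻ z, f z ∂(P.map fun ω => (X ω, Y ω)) :=
        (lintegral_map' hf.aemeasurable (hX.prodMk hY)).symm
    _ = ∫⁻ y, ∫⁻ x, f (x, y) ∂(P.map X) ∂(P.map Y) := by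
        rw [hmap, lintegral_prod_symm _ hf.aemeasurable]
    _ = ∫⁻ ω, ∫⁻ x, f (x, Y ω) ∂(P.map X) ∂P :=
        lintegral_map' (hf.lintegral_prod_left').aemeasurable hY
    _ = _ := by
        congr with ω
        exact lintegral_map' (hf.comp measurable_prodMk_right).aemeasurable hX

variable {ι : Type*} {ξ : ι → Ω → β}

/-- The index `i` occurs only once in the product, so `ξ i` can be integrated out first, which gives
0. The other three indices may coincide with one another, hence the finset `T` instead of a triple.
-/
lemma integral_mul_eq_zero_of_degenerate (hξ : iIndepFun ξ P) (hm : ∀ i, AEMeasurable (ξ i) P)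
    {f h : β → β → ℝ} (hf : Measurable (Function.uncurry f)) (hh : Measurable (Function.uncurry h))
    {i j i' j' : ι} (hij : i ≠ j) (hii' : i ≠ i') (hij' : i ≠ j')
    (hdeg : ∀ y, ∫ ω, f (ξ i ω) y ∂P = 0)
    (hint : Integrable (fun ω => f (ξ i ω) (ξ j ω) * h (ξ i' ω) (ξ j' ω)) P) :
    ∫ ω, f (ξ i ω) (ξ j ω) * h (ξ i' ω) (ξ j' ω) ∂P = 0 := by
  classical
  let T : Finset ι := {j, i', j'}
  have hd : Disjoint ({i} : Finset ι) T := by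
    simp [T, hij, hii', hij']
  have hind := iIndepFun.indepFun_finset₀ {i} T hd hξ hm
  have hind' : IndepFun (ξ i) (fun ω (x : T) => ξ x ω) P :=
    hind.comp (φ := fun g : ({i} : Finset ι) → β => g ⟨i, by simp⟩)
      (ψ := fun g : T → β => g) (by fun_prop) (by fun_prop)
  let F : β × (T → β) → ℝ := fun z => f z.1 (z.2 ⟨j, by simp [T]⟩)
    * h (z.2 ⟨i', by simp [T]⟩) (z.2 ⟨j', by simp [T]⟩)
  have hF : Measurable F := by
    refine Measurable.mul ?_ ?_
    · exact hf.comp (measurable_fst.prodMk ((measurable_pi_apply _).comp measurable_snd))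
    · exact hh.comp (f := fun z : β × (T → β) =>
        (z.2 ⟨i', by simp [T]⟩, z.2 ⟨j', by simp [T]⟩)) (by fun_prop)
  have key := integral_comp_prodMk_of_indepFun hind' (hm i)
    (aemeasurable_pi_lambda _ fun x => hm x) hF.stronglyMeasurable hint
  refine key.trans ?_
  simp only [F, integral_mul_const, hdeg, zero_mul, integral_zero]

/-- Second moment of a completely degenerate double sum. -/
lemma integral_sq_sum_offDiag_le [DecidableEq ι]
    (hξ : iIndepFun ξ P) (hm : ∀ i, AEMeasurable (ξ i) P)
    {f : ι → ι → β → β → ℝ} (hf : ∀ i j, Measurable (Function.uncurry (f i j)))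
    (s : Finset ι)
    (hdeg₁ : ∀ i ∈ s, ∀ j y, ∫ ω, f i j (ξ i ω) y ∂P = 0)
    (hdeg₂ : ∀ j ∈ s, ∀ i x, ∫ ω, f i j x (ξ j ω) ∂P = 0)
    (hL : ∀ p ∈ s.offDiag, MemLp (fun ω => f p.1 p.2 (ξ p.1 ω) (ξ p.2 ω)) 2 P) :
    ∫ ω, (∑ p ∈ s.offDiag, f p.1 p.2 (ξ p.1 ω) (ξ p.2 ω)) ^ 2 ∂P
      ≤ 2 * ∑ p ∈ s.offDiag, ∫ ω, (f p.1 p.2 (ξ p.1 ω) (ξ p.2 ω)) ^ 2 ∂P := by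
  set G : ι × ι → Ω → ℝ := fun p ω => f p.1 p.2 (ξ p.1 ω) (ξ p.2 ω) with hG
  have hint : ∀ p ∈ s.offDiag, ∀ q ∈ s.offDiag, Integrable (fun ω => G p ω * G q ω) P :=
    fun p hp q hq => (hL p hp).integrable_mul (hL q hq)
  set a : ι × ι → ℝ := fun p => ∫ ω, G p ω ^ 2 ∂P with ha
  have ha0 : ∀ p, 0 ≤ a p := fun p => integral_nonneg fun ω => sq_nonneg _
  have hexpand : ∫ ω, (∑ p ∈ s.offDiag, G p ω) ^ 2 ∂P
      = ∑ p ∈ s.offDiag, ∑ q ∈ s.offDiag, ∫ ω, G p ω * G q ω ∂P := by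
    simp_rw [sq, Finset.sum_mul_sum]
    rw [integral_finsetSum _ fun p hp => integrable_finsetSum _ fun q hq => hint p hp q hq]
    exact Finset.sum_congr rfl fun p hp => integral_finsetSum _ fun q hq => hint p hp q hq
  -- Only the pairs `q = p` and `q = p.swap` can contribute. No symmetry of the kernel is assumed,
  -- so the swapped term is estimated by `x y ≤ (x² + y²) / 2`; this produces the factor 2.
  have hbound : ∀ p ∈ s.offDiag, ∀ q ∈ s.offDiag, ∫ ω, G p ω * G q ω ∂P
      ≤ (if q = p then a p else 0) + (if q = p.swap then (a p + a q) / 2 else 0) := by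
    intro p hp q hq
    have hle : ∫ ω, G p ω * G q ω ∂P ≤ (a p + a q) / 2 := by
      rw [ha, ← integral_add (hL p hp).integrable_sq (hL q hq).integrable_sq, ← integral_div]
      refine integral_mono (hint p hp q hq)
        (((hL p hp).integrable_sq.add (hL q hq).integrable_sq).div_const 2) fun ω => ?_
      have := sq_nonneg (G p ω - G q ω)
      nlinarith
    by_cases h1 : q = p
    · subst h1
      have : 0 ≤ (if q = q.swap then (a q + a q) / 2 else 0) := by
        split_ifs
        · have := ha0 q; linarith
        · exact le_rfl
      simp only [if_true]
      linarith
    by_cases h2 : q = p.swap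
    · simp only [h2, if_true]
      rw [← h2]
      split_ifs
      all_goals linarith [ha0 p]
    simp only [h1, h2, if_false, add_zero]
    obtain ⟨p1, p2⟩ := p
    obtain ⟨q1, q2⟩ := q
    simp only [Finset.mem_offDiag] at hp hq
    simp only [Prod.mk.injEq, Prod.swap_prod_mk] at h1 h2
    refine le_of_eq ?_
    -- Since `q` is neither `p` nor its swap, some index of `p` is absent from `q`. It is `p2` in
    -- the first case, where the kernel is transposed to bring `p2` into first position, and `p1` in
    -- the second.
    by_cases h3 : p1 = q1 ∨ p1 = q2
    · have h4 : p2 ≠ q1 ∧ p2 ≠ q2 := by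
        have := hq.2.2; have := hp.2.2; grind
      refine integral_mul_eq_zero_of_degenerate (f := fun x y => f p1 p2 y x) hξ hm
        ((hf p1 p2).comp measurable_swap) (hf q1 q2) hp.2.2.symm h4.1 h4.2 (hdeg₂ p2 hp.2.1 p1) ?_
      exact hint (p1, p2) (by simpa using hp) (q1, q2) (by simpa using hq)
    · push Not at h3
      exact integral_mul_eq_zero_of_degenerate hξ hm (hf p1 p2) (hf q1 q2) hp.2.2 h3.1 h3.2
        (hdeg₁ p1 hp.1 p2) (hint (p1, p2) (by simpa using hp) (q1, q2) (by simpa using hq))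
  have hswap : ∑ p ∈ s.offDiag, a p.swap = ∑ p ∈ s.offDiag, a p :=
    Finset.sum_equiv (Equiv.prodComm ι ι)
      (fun p => by simp only [Finset.mem_offDiag, Equiv.prodComm_apply, Prod.fst_swap,
        Prod.snd_swap]; tauto) (fun p _ => rfl)
  rw [hexpand]
  calc _ ≤ ∑ p ∈ s.offDiag, ∑ q ∈ s.offDiag,
        ((if q = p then a p else 0) + (if q = p.swap then (a p + a q) / 2 else 0)) :=
        Finset.sum_le_sum fun p hp => Finset.sum_le_sum fun q hq => hbound p hp q hq
    _ = ∑ p ∈ s.offDiag, (a p + (a p + a p.swap) / 2) := by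
        refine Finset.sum_congr rfl fun p hp => ?_
        have hp' : p.swap ∈ s.offDiag := by
          simp only [Finset.mem_offDiag, Prod.fst_swap, Prod.snd_swap] at hp ⊢; tauto
        rw [Finset.sum_add_distrib, Finset.sum_ite_eq' , Finset.sum_ite_eq', if_pos hp, if_pos hp']
    _ = _ := by
        rw [Finset.sum_add_distrib, ← Finset.sum_div, Finset.sum_add_distrib, hswap]
        ring

end Independence

end Subbagging

noncomputable section

namespace Subbagging

/-! ### Functions of variables with finitely many values -/

section FiniteValued

variable {Ω β : Type*} [MeasurableSpace Ω] [MeasurableSpace β] [Countable β]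
  [MeasurableSingletonClass β] {P : Measure Ω} [IsProbabilityMeasure P]

/-- On a countable discrete space every function is measurable, and on a finite set it is bounded.
This settles every integrability question about functions of the subsamples. -/
lemma memLp_comp_of_ae_mem_finset {E : Type*} [NormedAddCommGroup E] {Y : Ω → β}
    (hY : AEMeasurable Y P) {A : Finset β}
    (hA : ∀ᵐ ω ∂P, Y ω ∈ A) (f : β → E) (p : ℝ≥0∞) : MemLp (fun ω => f (Y ω)) p P := by
  have hsm : StronglyMeasurable f := .of_discrete
  refine MemLp.of_bound (hsm.aestronglyMeasurable.comp_aemeasurable hY) (∑ y ∈ A, ‖f y‖) ?_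
  filter_upwards [hA] with ω hω
  exact Finset.single_le_sum (f := fun y => ‖f y‖) (fun y _ => norm_nonneg _) hω

lemma integrable_comp_of_ae_mem_finset {E : Type*} [NormedAddCommGroup E] {Y : Ω → β}
    (hY : AEMeasurable Y P) {A : Finset β}
    (hA : ∀ᵐ ω ∂P, Y ω ∈ A) (f : β → E) : Integrable (fun ω => f (Y ω)) P :=
  (memLp_comp_of_ae_mem_finset hY hA f 1).integrable le_rfl

end FiniteValued

/-- The indicator of `i ∈ s`, as a real number. -/
def incl (s : Finset ℕ) (i : ℕ) : ℝ := if i ∈ s then 1 else 0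

lemma incl_eq_zero_or_one (s : Finset ℕ) (i : ℕ) : incl s i = 0 ∨ incl s i = 1 := by
  unfold incl; split_ifs <;> simp

lemma incl_nonneg (s : Finset ℕ) (i : ℕ) : 0 ≤ incl s i := by
  rcases incl_eq_zero_or_one s i with h | h <;> simp [h]

lemma incl_mul_self (s : Finset ℕ) (i : ℕ) : incl s i * incl s i = incl s i := by
  rcases incl_eq_zero_or_one s i with h | h <;> simp [h]

lemma sum_range_incl {k N : ℕ} {s : Finset ℕ} (hs : s ∈ Finset.powersetCard k (Finset.range N)) :
    ∑ i ∈ Finset.range N, incl s i = k := by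
  rw [Finset.mem_powersetCard] at hs
  simp only [incl, Finset.sum_ite_mem, Finset.inter_eq_right.2 hs.1, Finset.sum_const, hs.2]
  simp

lemma sum_range_incl_smul {E : Type*} [AddCommGroup E] [Module ℝ E] {k N : ℕ} {s : Finset ℕ}
    (hs : s ∈ Finset.powersetCard k (Finset.range N)) (f : ℕ → E) :
    ∑ i ∈ Finset.range N, incl s i • f i = ∑ i ∈ s, f i := by
  rw [Finset.mem_powersetCard] at hs
  simp only [incl, ite_smul, one_smul, zero_smul, Finset.sum_ite_mem, Finset.inter_eq_right.2 hs.1]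

/-! ### Moments of sums of independent indicators -/

section Bernoulli

variable {Ω ι : Type*} [MeasurableSpace Ω] {P : Measure Ω} [IsProbabilityMeasure P]

/-- Bounds for the second and third moments of a sum of independent Bernoulli variables. -/
lemma moments_sum_bernoulli_le {X : ι → Ω → ℝ} (hX : iIndepFun X P) (hm : ∀ i, Measurable (X i))
    (h01 : ∀ i ω, X i ω = 0 ∨ X i ω = 1) {q : ℝ} (hq : ∀ i, ∫ ω, X i ω ∂P = q) (s : Finset ι) :
    ∫ ω, (∑ i ∈ s, X i ω) ^ 2 ∂P ≤ s.card * q + s.card ^ 2 * q ^ 2 ∧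
    ∫ ω, (∑ i ∈ s, X i ω) ^ 3 ∂P ≤ s.card * q + 3 * s.card ^ 2 * q ^ 2 + s.card ^ 3 * q ^ 3 := by
  classical
  have hX1 : ∀ i ω, ‖X i ω‖ ≤ 1 := fun i ω => by rcases h01 i ω with h | h <;> simp [h]
  have hbd : ∀ (t : Finset ι) (ω : Ω), ‖∑ i ∈ t, X i ω‖ ≤ t.card := fun t ω => by
    refine (norm_sum_le_of_le t fun i _ => hX1 i ω).trans (by simp)
  have hTm : ∀ t : Finset ι, Measurable fun ω => ∑ i ∈ t, X i ω :=
    fun t => Finset.measurable_sum _ fun i _ => hm i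
  have hTint : ∀ (t : Finset ι) (n : ℕ), Integrable (fun ω => (∑ i ∈ t, X i ω) ^ n) P :=
    fun t n => Integrable.of_bound ((hTm t).pow_const n).aestronglyMeasurable ((t.card : ℝ) ^ n)
      (.of_forall fun ω => by rw [norm_pow]; exact pow_le_pow_left₀ (norm_nonneg _) (hbd t ω) n)
  have hXint : ∀ i, Integrable (X i) P := fun i =>
    Integrable.of_bound (hm i).aestronglyMeasurable 1 (.of_forall (hX1 i))
  induction s using Finset.induction_on with
  | empty => simp
  | insert a s ha ih =>
    obtain ⟨ih2, ih3⟩ := ih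
    have hq0 : 0 ≤ q := by
      rw [← hq a]
      exact integral_nonneg fun ω => by rcases h01 a ω with h | h <;> simp [h]
    have hind : IndepFun (fun ω => ∑ i ∈ s, X i ω) (X a) P := by
      have := hX.indepFun_finsetSum_of_notMem hm ha
      convert this using 1
      ext ω; simp
    have hmulInt : ∀ n : ℕ, Integrable (fun ω => (∑ i ∈ s, X i ω) ^ n * X a ω) P := fun n =>
      (hTint s n).mul_bdd (c := 1) (hm a).aestronglyMeasurable (.of_forall (hX1 a))
    have hmul : ∀ n : ℕ, ∫ ω, (∑ i ∈ s, X i ω) ^ n * X a ω ∂P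
        = (∫ ω, (∑ i ∈ s, X i ω) ^ n ∂P) * q := fun n => by
      rw [← hq a]
      exact (hind.comp (φ := fun x : ℝ => x ^ n) (ψ := fun x : ℝ => x) (by fun_prop)
        measurable_id).integral_fun_mul_eq_mul_integral (hTint s n).aestronglyMeasurable
          (hXint a).aestronglyMeasurable
    have h1 : ∫ ω, (∑ i ∈ s, X i ω) ∂P = s.card * q := by
      rw [integral_finsetSum _ fun i _ => hXint i]
      simp [hq]
    -- As `X a` takes only the values 0 and 1, its powers collapse to `X a`, and independence
    -- reduces each mixed term to a lower moment of the old sum times `q`. The exact moments contain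
    -- falling factorials of the number of summands; the claimed bounds have powers in their place.
    have e2 : ∀ ω, (∑ i ∈ insert a s, X i ω) ^ 2
        = (∑ i ∈ s, X i ω) ^ 2 + 2 * ((∑ i ∈ s, X i ω) ^ 1 * X a ω) + X a ω := fun ω => by
      rw [Finset.sum_insert ha]
      rcases h01 a ω with h | h <;> rw [h] <;> ring
    have e3 : ∀ ω, (∑ i ∈ insert a s, X i ω) ^ 3
        = (∑ i ∈ s, X i ω) ^ 3 + 3 * ((∑ i ∈ s, X i ω) ^ 2 * X a ω)
          + 3 * ((∑ i ∈ s, X i ω) ^ 1 * X a ω) + X a ω := fun ω => by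
      rw [Finset.sum_insert ha]
      rcases h01 a ω with h | h <;> rw [h] <;> ring
    have i1 := (hmulInt 1).const_mul 2
    have i1' := (hmulInt 1).const_mul 3
    have i2 := (hmulInt 2).const_mul 3
    have i3 : Integrable (fun ω => (∑ i ∈ s, X i ω) ^ 2
        + 2 * ((∑ i ∈ s, X i ω) ^ 1 * X a ω)) P := (hTint s 2).add i1
    have i4 : Integrable (fun ω => (∑ i ∈ s, X i ω) ^ 3
        + 3 * ((∑ i ∈ s, X i ω) ^ 2 * X a ω)) P := (hTint s 3).add i2
    have i5 : Integrable (fun ω => (∑ i ∈ s, X i ω) ^ 3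
        + 3 * ((∑ i ∈ s, X i ω) ^ 2 * X a ω) + 3 * ((∑ i ∈ s, X i ω) ^ 1 * X a ω)) P := i4.add i1'
    have hc : ((insert a s).card : ℝ) = s.card + 1 := by
      rw [Finset.card_insert_of_notMem ha]; push_cast; ring
    have hn : (0 : ℝ) ≤ s.card := Nat.cast_nonneg _
    constructor
    · simp_rw [e2]
      rw [integral_add i3 (hXint a), integral_add (hTint s 2) i1, integral_const_mul, hmul, hq]
      simp only [pow_one]
      rw [h1, hc]
      nlinarith [sq_nonneg q]
    · simp_rw [e3]
      rw [integral_add i5 (hXint a), integral_add i4 i1', integral_add (hTint s 3) i2,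
        integral_const_mul, integral_const_mul, hmul, hmul, hq]
      simp only [pow_one]
      rw [h1, hc]
      have := mul_le_mul_of_nonneg_right ih2 hq0
      have h5 : 0 ≤ q ^ 3 := by positivity
      have h6 : 0 ≤ (s.card : ℝ) * q ^ 3 := by positivity
      nlinarith [sq_nonneg q]

end Bernoulli

/-! ### Uniform random subsets and their inclusion indicators -/

section UniformSubset

variable {Ω : Type*} [MeasurableSpace Ω] {P : Measure Ω} [IsProbabilityMeasure P]

/-- `S` is uniformly distributed on the subsets of `{0, …, N - 1}` of size `k`. -/
structure IsUniformSubset (P : Measure Ω) (k N : ℕ) (S : Ω → Finset ℕ) : Prop where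
  measurable : Measurable S
  measure_eq : ∀ s ∈ Finset.powersetCard k (Finset.range N),
    P {ω | S ω = s} = (N.choose k : ℝ≥0∞)⁻¹

namespace IsUniformSubset

variable {k N : ℕ} {S : Ω → Finset ℕ}

/-- Only the point masses are prescribed. There are `N.choose k` of them, so they already add up to
1; `k ≤ N` makes the binomial coefficient nonzero. -/
lemma ae_mem (hS : IsUniformSubset P k N S) (hk : k ≤ N) :
    ∀ᵐ ω ∂P, S ω ∈ Finset.powersetCard k (Finset.range N) := by
  have hme : MeasurableSet {ω | S ω ∈ Finset.powersetCard k (Finset.range N)} :=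
    hS.measurable (Finset.measurableSet (Finset.powersetCard k (Finset.range N)))
  have he : {ω | S ω ∈ Finset.powersetCard k (Finset.range N)}
      = ⋃ s ∈ Finset.powersetCard k (Finset.range N), {ω | S ω = s} := by
    ext ω; simp
  refine (mem_ae_iff_prob_eq_one hme).2 ?_
  rw [he, measure_biUnion_finset]
  · rw [Finset.sum_congr rfl hS.measure_eq]
    simp only [Finset.sum_const, Finset.card_powersetCard, Finset.card_range, nsmul_eq_mul]
    exact ENNReal.mul_inv_cancel (by exact_mod_cast (Nat.choose_pos hk).ne') (by simp)
  · intro s _ t _ hst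
    exact Set.disjoint_left.2 fun ω h1 h2 => hst (h1.symm.trans h2)
  · exact fun s _ => hS.measurable (measurableSet_singleton s)

lemma integral_comp (hS : IsUniformSubset P k N S) (hk : k ≤ N) (f : Finset ℕ → ℝ) :
    ∫ ω, f (S ω) ∂P
      = (∑ s ∈ Finset.powersetCard k (Finset.range N), f s) / (N.choose k : ℝ) := by
  have h1 : (fun ω => f (S ω)) =ᵐ[P] fun ω =>
      ∑ s ∈ Finset.powersetCard k (Finset.range N),
        ({ω | S ω = s} : Set Ω).indicator (fun _ => f s) ω := by
    filter_upwards [hS.ae_mem hk] with ω hω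
    rw [Finset.sum_eq_single_of_mem (S ω) hω]
    · simp
    · intro s _ hs
      exact Set.indicator_of_notMem (by simpa using hs.symm) _
  rw [integral_congr_ae h1, integral_finsetSum]
  · rw [Finset.sum_div]
    refine Finset.sum_congr rfl fun s hs => ?_
    have hms : MeasurableSet {ω | S ω = s} := hS.measurable (measurableSet_singleton s)
    rw [integral_indicator_const _ hms, measureReal_def, hS.measure_eq s hs]
    simp [div_eq_inv_mul]
  · intro s _
    exact (integrable_const _).indicator (hS.measurable (measurableSet_singleton s))

lemma integral_incl (hS : IsUniformSubset P k N S) (hk1 : 1 ≤ k) (hk : k ≤ N) {i : ℕ}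
    (hi : i < N) : ∫ ω, incl (S ω) i ∂P = k / N := by
  rw [hS.integral_comp hk fun s => incl s i]
  have h1 : ∑ s ∈ Finset.powersetCard k (Finset.range N), incl s i
      = (((Finset.powersetCard k (Finset.range N)).filter ({i} ⊆ ·)).card : ℝ) := by
    rw [Finset.card_filter]
    push_cast
    exact Finset.sum_congr rfl fun s _ => by simp [incl]
  rw [h1, Finset.card_filter_powersetCard_subset _ _ _ (by simpa using hi) (by simpa using hk1)]
  simp only [Finset.card_range, Finset.card_singleton]
  obtain ⟨n, rfl⟩ : ∃ n, N = n + 1 := ⟨N - 1, by omega⟩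
  obtain ⟨l, rfl⟩ : ∃ l, k = l + 1 := ⟨k - 1, by omega⟩
  have h2 := Nat.add_one_mul_choose_eq n l
  have h3 : ((n + 1).choose (l + 1) : ℝ) ≠ 0 := by exact_mod_cast (Nat.choose_pos hk).ne'
  have h4 : ((n : ℝ) + 1) * n.choose l = (n + 1).choose (l + 1) * (l + 1) := by exact_mod_cast h2
  have h5 : ((n + 1 : ℕ) : ℝ) ≠ 0 := by positivity
  rw [div_eq_div_iff h3 h5]
  push_cast
  linarith

lemma integral_incl_mul_incl (hS : IsUniformSubset P k N S) (hk1 : 2 ≤ k) (hk : k ≤ N) {i j : ℕ}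
    (hi : i < N) (hj : j < N) (hij : i ≠ j) :
    ∫ ω, incl (S ω) i * incl (S ω) j ∂P = (k * (k - 1)) / (N * (N - 1)) := by
  rw [hS.integral_comp hk fun s => incl s i * incl s j]
  have h1 : ∑ s ∈ Finset.powersetCard k (Finset.range N), incl s i * incl s j
      = (((Finset.powersetCard k (Finset.range N)).filter ({i, j} ⊆ ·)).card : ℝ) := by
    rw [Finset.card_filter]
    push_cast
    refine Finset.sum_congr rfl fun s _ => ?_
    simp only [incl, Finset.insert_subset_iff, Finset.singleton_subset_iff]
    split_ifs <;> simp_all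
  have hc : ({i, j} : Finset ℕ).card = 2 := Finset.card_pair hij
  rw [h1, Finset.card_filter_powersetCard_subset _ _ _
    (by simp [Finset.insert_subset_iff, hi, hj]) (by rw [hc]; exact hk1), hc]
  simp only [Finset.card_range]
  obtain ⟨n, rfl⟩ : ∃ n, N = n + 2 := ⟨N - 2, by omega⟩
  obtain ⟨l, rfl⟩ : ∃ l, k = l + 2 := ⟨k - 2, by omega⟩
  have h2 := Nat.add_one_mul_choose_eq n l
  have h2' := Nat.add_one_mul_choose_eq (n + 1) (l + 1)
  have h3 : ((n + 2).choose (l + 2) : ℝ) ≠ 0 := by exact_mod_cast (Nat.choose_pos hk).ne'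
  have h4 : ((n : ℝ) + 1) * n.choose l = (n + 1).choose (l + 1) * (l + 1) := by exact_mod_cast h2
  have h4' : ((n : ℝ) + 1 + 1) * (n + 1).choose (l + 1)
      = (n + 2).choose (l + 2) * (l + 1 + 1) := by exact_mod_cast h2'
  have h5 : ((n + 2 : ℕ) : ℝ) * (((n + 2 : ℕ) : ℝ) - 1) ≠ 0 := by
    push_cast
    have : (0 : ℝ) ≤ n := Nat.cast_nonneg _
    have h6 : (n : ℝ) + 2 - 1 ≠ 0 := by linarith
    positivity
  rw [div_eq_div_iff h3 h5]
  push_cast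
  linear_combination ((n : ℝ) + 2) * h4 + (l + 1 : ℝ) * h4'

lemma integrable_comp (hS : IsUniformSubset P k N S) (hk : k ≤ N) (f : Finset ℕ → ℝ) :
    Integrable (fun ω => f (S ω)) P :=
  integrable_comp_of_ae_mem_finset hS.measurable.aemeasurable (hS.ae_mem hk) f

end IsUniformSubset

/-- The covariance-type kernel of the inclusion indicators of two subsets. -/
def overlapKernel (k N : ℕ) (s t : Finset ℕ) : ℝ :=
  ∑ i ∈ Finset.range N, (incl s i - k / N) * (incl t i - k / N)

/-- Each indicator is centred at its mean `k / N`. This is the degeneracy needed to treat sums over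
pairs of subsamples by `integral_sq_sum_offDiag_le`. -/
lemma integral_overlapKernel {k N : ℕ} {S : Ω → Finset ℕ} (hS : IsUniformSubset P k N S)
    (hk1 : 1 ≤ k) (hk : k ≤ N) (t : Finset ℕ) : ∫ ω, overlapKernel k N (S ω) t ∂P = 0 := by
  unfold overlapKernel
  rw [integral_finsetSum _ fun i _ =>
    hS.integrable_comp hk fun s => (incl s i - k / N) * (incl t i - k / N)]
  refine Finset.sum_eq_zero fun i hi => ?_
  rw [integral_mul_const, integral_sub (hS.integrable_comp hk fun s => incl s i)
    (integrable_const _), hS.integral_incl hk1 hk (Finset.mem_range.1 hi)]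
  simp

lemma overlapKernel_comm (k N : ℕ) (s t : Finset ℕ) :
    overlapKernel k N s t = overlapKernel k N t s :=
  Finset.sum_congr rfl fun _ _ => mul_comm _ _

lemma overlapKernel_eq {k N : ℕ} (hN : N ≠ 0) {s t : Finset ℕ}
    (hs : s ∈ Finset.powersetCard k (Finset.range N))
    (ht : t ∈ Finset.powersetCard k (Finset.range N)) :
    overlapKernel k N s t = ∑ i ∈ Finset.range N, incl s i * incl t i - k ^ 2 / N := by
  have hN' : (N : ℝ) ≠ 0 := by exact_mod_cast hN
  have h : ∀ i, (incl s i - (k : ℝ) / N) * (incl t i - k / N)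
      = incl s i * incl t i - k / N * incl s i - k / N * incl t i + (k / N) ^ 2 := fun i => by ring
  unfold overlapKernel
  simp_rw [h, Finset.sum_add_distrib, Finset.sum_sub_distrib, ← Finset.mul_sum,
    sum_range_incl hs, sum_range_incl ht, Finset.sum_const, Finset.card_range, nsmul_eq_mul]
  field_simp
  ring

/-- For subsets of size `k` the kernel is the size of the overlap minus `k² / N`. The overlap has
mean `k² / N`, and its variance does not exceed its mean because sampling without replacement
correlates the inclusion indicators negatively. -/
lemma integral_overlapKernel_sq_le {k N : ℕ} {S T : Ω → Finset ℕ} (hS : IsUniformSubset P k N S)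
    (hT : IsUniformSubset P k N T) (hST : IndepFun S T P) (hk2 : 2 ≤ k) (hk : k ≤ N) :
    ∫ ω, overlapKernel k N (S ω) (T ω) ^ 2 ∂P ≤ (k : ℝ) ^ 2 / N := by
  have hmul : ∀ f g : Finset ℕ → ℝ, ∫ ω, f (S ω) * g (T ω) ∂P
      = (∫ ω, f (S ω) ∂P) * ∫ ω, g (T ω) ∂P := fun f g =>
    (hST.comp (φ := f) (ψ := g) .of_discrete .of_discrete).integral_fun_mul_eq_mul_integral
      (hS.integrable_comp hk f).aestronglyMeasurable (hT.integrable_comp hk g).aestronglyMeasurable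
  have hmeas : AEMeasurable (fun ω => (S ω, T ω)) P :=
    (hS.measurable.prodMk hT.measurable).aemeasurable
  have hae : ∀ᵐ ω ∂P, (S ω, T ω) ∈ Finset.powersetCard k (Finset.range N) ×ˢ
      Finset.powersetCard k (Finset.range N) := by
    filter_upwards [hS.ae_mem hk, hT.ae_mem hk] with ω h1 h2
    exact Finset.mk_mem_product h1 h2
  have hint : ∀ f : Finset ℕ × Finset ℕ → ℝ, Integrable (fun ω => f (S ω, T ω)) P :=
    fun f => integrable_comp_of_ae_mem_finset hmeas hae f
  have hN : (2 : ℝ) ≤ N := by exact_mod_cast hk2.trans hk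
  set I : Ω → ℝ := fun ω => ∑ i ∈ Finset.range N, incl (S ω) i * incl (T ω) i with hI
  have h1 : ∫ ω, I ω ∂P = (k : ℝ) ^ 2 / N := by
    rw [hI, integral_finsetSum _ fun i _ => hint fun z => incl z.1 i * incl z.2 i]
    rw [Finset.sum_congr rfl fun i hi => (hmul (fun s => incl s i) (fun s => incl s i)).trans
      (by rw [hS.integral_incl (by omega) hk (Finset.mem_range.1 hi),
        hT.integral_incl (by omega) hk (Finset.mem_range.1 hi)])]
    rw [Finset.sum_const, Finset.card_range, nsmul_eq_mul]
    field_simp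
  have h2 : ∫ ω, I ω ^ 2 ∂P = (k : ℝ) ^ 2 / N
      + N * (N - 1) * ((k * (k - 1)) / (N * (N - 1))) ^ 2 := by
    have e : ∀ ω, I ω ^ 2 = ∑ i ∈ Finset.range N, ∑ j ∈ Finset.range N,
        (incl (S ω) i * incl (S ω) j) * (incl (T ω) i * incl (T ω) j) := fun ω => by
      rw [hI, sq, Finset.sum_mul_sum]
      exact Finset.sum_congr rfl fun i _ => Finset.sum_congr rfl fun j _ => by ring
    simp_rw [e]
    rw [integral_finsetSum _ fun i _ => hint fun z => ∑ j ∈ Finset.range N,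
        (incl z.1 i * incl z.1 j) * (incl z.2 i * incl z.2 j)]
    have e2 : ∀ i ∈ Finset.range N, ∫ ω, ∑ j ∈ Finset.range N,
        (incl (S ω) i * incl (S ω) j) * (incl (T ω) i * incl (T ω) j) ∂P
        = ((k : ℝ) / N) ^ 2 + (N - 1) * ((k * (k - 1)) / (N * (N - 1))) ^ 2 := by
      intro i hi
      rw [integral_finsetSum _ fun j _ => hint fun z =>
        (incl z.1 i * incl z.1 j) * (incl z.2 i * incl z.2 j)]
      rw [← Finset.add_sum_erase _ _ hi]
      congr 1
      · simp_rw [incl_mul_self]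
        rw [hmul (fun s => incl s i) (fun s => incl s i),
          hS.integral_incl (by omega) hk (Finset.mem_range.1 hi),
          hT.integral_incl (by omega) hk (Finset.mem_range.1 hi), sq]
      · rw [Finset.sum_congr rfl fun j hj => (hmul (fun s => incl s i * incl s j)
          (fun s => incl s i * incl s j)).trans
          (by rw [hS.integral_incl_mul_incl hk2 hk (Finset.mem_range.1 hi)
              (Finset.mem_range.1 (Finset.mem_of_mem_erase hj)) (Finset.ne_of_mem_erase hj).symm,
            hT.integral_incl_mul_incl hk2 hk (Finset.mem_range.1 hi)
              (Finset.mem_range.1 (Finset.mem_of_mem_erase hj)) (Finset.ne_of_mem_erase hj).symm])]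
        rw [Finset.sum_const, Finset.card_erase_of_mem hi, Finset.card_range, nsmul_eq_mul,
          Nat.cast_sub (by omega), sq]
        simp
    rw [Finset.sum_congr rfl e2, Finset.sum_const, Finset.card_range, nsmul_eq_mul]
    field_simp
  have h3 : ∫ ω, overlapKernel k N (S ω) (T ω) ^ 2 ∂P = ∫ ω, (I ω - (k : ℝ) ^ 2 / N) ^ 2 ∂P := by
    refine integral_congr_ae ?_
    filter_upwards [hS.ae_mem hk, hT.ae_mem hk] with ω h1 h2
    rw [overlapKernel_eq (by omega) h1 h2]
  have hI1 : Integrable I P :=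
    hint fun z => ∑ i ∈ Finset.range N, incl z.1 i * incl z.2 i
  have hI2 : Integrable (fun ω => I ω ^ 2) P :=
    hint fun z => (∑ i ∈ Finset.range N, incl z.1 i * incl z.2 i) ^ 2
  have h4 : ∫ ω, (I ω - (k : ℝ) ^ 2 / N) ^ 2 ∂P
      = ∫ ω, I ω ^ 2 ∂P - ((k : ℝ) ^ 2 / N) ^ 2 := by
    have e : ∀ ω, (I ω - (k : ℝ) ^ 2 / N) ^ 2
        = I ω ^ 2 - 2 * ((k : ℝ) ^ 2 / N) * I ω + ((k : ℝ) ^ 2 / N) ^ 2 := fun ω => by ring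
    simp_rw [e]
    have i1 : Integrable (fun ω => I ω ^ 2 - 2 * ((k : ℝ) ^ 2 / N) * I ω) P :=
      hI2.sub (hI1.const_mul _)
    rw [integral_add i1 (integrable_const _), integral_sub hI2 (hI1.const_mul _),
      integral_const_mul, h1]
    simp
    ring
  rw [h3, h4, h2]
  have hk' : (2 : ℝ) ≤ k := by exact_mod_cast hk2
  have hkN : (k : ℝ) ≤ N := by exact_mod_cast hk
  have hN1 : (0 : ℝ) < N - 1 := by linarith
  have h5 : (N : ℝ) * (N - 1) * ((k * (k - 1)) / (N * (N - 1))) ^ 2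
      = k ^ 2 * ((k - 1) / N * ((k - 1) / (N - 1))) := by
    field_simp
  have h6 : ((k : ℝ) ^ 2 / N) ^ 2 = k ^ 2 * (k / N * (k / N)) := by
    field_simp
  -- The negative correlation: given that one observation is included, another one is included with
  -- probability `(k - 1) / (N - 1)`, at most `k / N`.
  have h7 : ((k : ℝ) - 1) / (N - 1) ≤ k / N := by
    rw [div_le_div_iff₀ hN1 (by linarith)]
    nlinarith
  have h8 : ((k : ℝ) - 1) / N ≤ k / N := by gcongr; linarith
  have h9 : ((k : ℝ) - 1) / N * ((k - 1) / (N - 1)) ≤ k / N * (k / N) :=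
    mul_le_mul h8 h7 (div_nonneg (by linarith) hN1.le) (by positivity)
  rw [h5, h6]
  have := mul_le_mul_of_nonneg_left h9 (sq_nonneg (k : ℝ))
  linarith

end UniformSubset

/-! ### Counts over all subsamples -/

section Subsamples

variable {Ω : Type*} [MeasurableSpace Ω] {P : Measure Ω} [IsProbabilityMeasure P]
  {k m N : ℕ} {S : Fin m → Ω → Finset ℕ}

/-- The number of subsamples that contain the observation `i`. -/
def inclCount {m : ℕ} (S : Fin m → Finset ℕ) (i : ℕ) : ℝ := ∑ j, incl (S j) i

lemma inclCount_nonneg (S : Fin m → Finset ℕ) (i : ℕ) : 0 ≤ inclCount S i :=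
  Finset.sum_nonneg fun _ _ => incl_nonneg _ _

lemma ae_forall_mem (hS : ∀ j, IsUniformSubset P k N (S j)) (hk : k ≤ N) :
    ∀ᵐ ω ∂P, (fun j => S j ω) ∈
      Fintype.piFinset fun _ : Fin m => Finset.powersetCard k (Finset.range N) := by
  have := ae_all_iff.2 fun j => (hS j).ae_mem hk
  filter_upwards [this] with ω h
  exact Fintype.mem_piFinset.2 h

lemma measurable_subsamples {P : Measure Ω} (hS : ∀ j, IsUniformSubset P k N (S j)) :
    Measurable fun ω j => S j ω := measurable_pi_lambda _ fun j => (hS j).measurable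

lemma integrable_comp_subsamples (hS : ∀ j, IsUniformSubset P k N (S j)) (hk : k ≤ N)
    (f : (Fin m → Finset ℕ) → ℝ) : Integrable (fun ω => f fun j => S j ω) P :=
  integrable_comp_of_ae_mem_finset (measurable_subsamples hS).aemeasurable (ae_forall_mem hS hk) f

/-- Different observations have dependent counts, but for one fixed observation the indicators
across the subsamples are independent Bernoulli(`k / N`), and only the expectation of a sum over
observations is needed. -/
lemma integral_sum_inclCount_cube_le (hS : ∀ j, IsUniformSubset P k N (S j))
    (hind : iIndepFun S P) (hk1 : 1 ≤ k) (hk : k ≤ N) :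
    ∫ ω, ∑ i ∈ Finset.range N, inclCount (fun j => S j ω) i ^ 3 ∂P
      ≤ N * (m * (k / N) + 3 * m ^ 2 * (k / N) ^ 2 + m ^ 3 * (k / N) ^ 3) := by
  rw [integral_finsetSum _ fun i _ => integrable_comp_subsamples hS hk fun s => inclCount s i ^ 3]
  have h : ∀ i ∈ Finset.range N, ∫ ω, inclCount (fun j => S j ω) i ^ 3 ∂P
      ≤ m * (k / N) + 3 * m ^ 2 * (k / N) ^ 2 + m ^ 3 * (k / N) ^ 3 := by
    intro i hi
    have := (moments_sum_bernoulli_le (X := fun j ω => incl (S j ω) i) (P := P)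
      (hind.comp (fun _ s => incl s i) fun _ => .of_discrete)
      (fun j => (Measurable.of_discrete (f := fun s => incl s i)).comp (hS j).measurable)
      (fun j ω => incl_eq_zero_or_one _ _)
      (fun j => (hS j).integral_incl hk1 hk (Finset.mem_range.1 hi)) Finset.univ).2
    simpa [inclCount] using this
  refine (Finset.sum_le_sum h).trans (le_of_eq ?_)
  rw [Finset.sum_const, Finset.card_range, nsmul_eq_mul]

/-- For a fixed pair of observations the indicators of joint inclusion are independent Bernoulli
across subsamples. There are `N (N - 1)` ordered pairs. The result is the size of the weights in the
degenerate remainder. -/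
lemma integral_sum_pairCount_sq_le (hS : ∀ j, IsUniformSubset P k N (S j))
    (hind : iIndepFun S P) (hk2 : 2 ≤ k) (hk : k ≤ N) :
    ∫ ω, ∑ p ∈ (Finset.range N).offDiag, (∑ j, incl (S j ω) p.1 * incl (S j ω) p.2) ^ 2 ∂P
      ≤ m * (k * (k - 1)) + m ^ 2 * (k * (k - 1)) ^ 2 / (N * (N - 1)) := by
  rw [integral_finsetSum _ fun p _ => integrable_comp_subsamples hS hk
    fun s => (∑ j, incl (s j) p.1 * incl (s j) p.2) ^ 2]
  set ρ : ℝ := (k * (k - 1)) / (N * (N - 1)) with hρ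
  have h : ∀ p ∈ (Finset.range N).offDiag,
      ∫ ω, (∑ j, incl (S j ω) p.1 * incl (S j ω) p.2) ^ 2 ∂P ≤ m * ρ + m ^ 2 * ρ ^ 2 := by
    intro p hp
    rw [Finset.mem_offDiag, Finset.mem_range, Finset.mem_range] at hp
    have := (moments_sum_bernoulli_le (X := fun j ω => incl (S j ω) p.1 * incl (S j ω) p.2) (P := P)
      (hind.comp (fun _ s => incl s p.1 * incl s p.2) fun _ => .of_discrete)
      (fun j => (Measurable.of_discrete (f := fun s => incl s p.1 * incl s p.2)).comp
        (hS j).measurable)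
      (fun j ω => by
        rcases incl_eq_zero_or_one (S j ω) p.1 with h | h <;>
        rcases incl_eq_zero_or_one (S j ω) p.2 with h' | h' <;> simp [h, h'])
      (fun j => (hS j).integral_incl_mul_incl hk2 hk hp.1 hp.2.1 hp.2.2) Finset.univ).1
    simpa using this
  refine (Finset.sum_le_sum h).trans (le_of_eq ?_)
  have hN : (2 : ℝ) ≤ N := by exact_mod_cast hk2.trans hk
  have hN1 : (N : ℝ) - 1 ≠ 0 := by linarith
  rw [Finset.sum_const, Finset.offDiag_card, Finset.card_range, nsmul_eq_mul,
    Nat.cast_sub (Nat.le_mul_self N), hρ]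
  push_cast
  field_simp

/-- Centring each count at `m k / N` turns the sum of squares into a double sum of `overlapKernel`.
Its diagonal is deterministic, each term being `k (1 - k / N)`, so only pairs of distinct subsamples
carry randomness. -/
lemma sum_inclCount_sq_eq (hk1 : 1 ≤ k) (hk : k ≤ N) {s : Fin m → Finset ℕ}
    (hs : ∀ j, s j ∈ Finset.powersetCard k (Finset.range N)) :
    ∑ i ∈ Finset.range N, inclCount s i ^ 2
      = (m * k) ^ 2 * ((1 - k / N) / (m * k) + 1 / N)
        + ∑ p ∈ (Finset.univ : Finset (Fin m)).offDiag, overlapKernel k N (s p.1) (s p.2) := by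
  have hN : (N : ℝ) ≠ 0 := by have : 0 < N := by omega
                              positivity
  have hk0 : (k : ℝ) ≠ 0 := by positivity
  have h1 : ∑ i ∈ Finset.range N, (inclCount s i - m * (k / N)) ^ 2
      = ∑ j, ∑ l, overlapKernel k N (s j) (s l) := by
    have e : ∀ i, inclCount s i - m * ((k : ℝ) / N) = ∑ j, (incl (s j) i - k / N) := fun i => by
      rw [Finset.sum_sub_distrib]; simp [inclCount]
    simp_rw [e, sq, Finset.sum_mul_sum, overlapKernel]
    rw [Finset.sum_comm]
    exact Finset.sum_congr rfl fun j _ => Finset.sum_comm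
  have h2 : ∑ j, ∑ l, overlapKernel k N (s j) (s l)
      = ∑ j, overlapKernel k N (s j) (s j)
        + ∑ p ∈ (Finset.univ : Finset (Fin m)).offDiag, overlapKernel k N (s p.1) (s p.2) := by
    rw [← Finset.sum_product', ← Finset.diag_union_offDiag,
      Finset.sum_union (Finset.disjoint_diag_offDiag _), Finset.sum_diag]
  have h3 : ∀ j, overlapKernel k N (s j) (s j) = k * (1 - k / N) := fun j => by
    rw [overlapKernel_eq (by omega) (hs j) (hs j)]
    simp_rw [incl_mul_self]
    rw [sum_range_incl (hs j)]
    ring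
  have h4 : ∑ i ∈ Finset.range N, inclCount s i = m * k := by
    unfold inclCount
    rw [Finset.sum_comm, Finset.sum_congr rfl fun j _ => sum_range_incl (hs j)]
    simp
  have h5 : ∑ i ∈ Finset.range N, (inclCount s i - m * ((k : ℝ) / N)) ^ 2
      = ∑ i ∈ Finset.range N, inclCount s i ^ 2 - (m * k) ^ 2 / N := by
    have e : ∀ i, (inclCount s i - m * ((k : ℝ) / N)) ^ 2
        = inclCount s i ^ 2 - 2 * (m * ((k : ℝ) / N)) * inclCount s i + (m * ((k : ℝ) / N)) ^ 2 :=
      fun i => by ring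
    simp_rw [e, Finset.sum_add_distrib, Finset.sum_sub_distrib, ← Finset.mul_sum, h4,
      Finset.sum_const, Finset.card_range, nsmul_eq_mul]
    field_simp
    ring
  rw [h5, h2, Finset.sum_congr rfl fun j _ => h3 j] at h1
  simp only [Finset.sum_const, Finset.card_univ, Fintype.card_fin, nsmul_eq_mul] at h1
  have h6 : ((m : ℝ) * k) ^ 2 * ((1 - k / N) / (m * k) + 1 / N)
      = m * (k * (1 - k / N)) + (m * k) ^ 2 / N := by
    rcases eq_or_ne (m : ℝ) 0 with h | h
    · simp [h]
    · field_simp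
  rw [h6]
  linarith

lemma integral_abs_sum_overlapKernel_le (hS : ∀ j, IsUniformSubset P k N (S j))
    (hind : iIndepFun S P) (hk2 : 2 ≤ k) (hk : k ≤ N) (hm : 0 < m) :
    ∫ ω, |∑ p ∈ (Finset.univ : Finset (Fin m)).offDiag,
        overlapKernel k N (S p.1 ω) (S p.2 ω)| ∂P ≤ 2 * (m * k) / √N := by
  set G : Ω → ℝ := fun ω => ∑ p ∈ (Finset.univ : Finset (Fin m)).offDiag,
        overlapKernel k N (S p.1 ω) (S p.2 ω) with hG
  have hN : (0 : ℝ) < N := by have : 0 < N := by omega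
                              positivity
  have hk0 : (0 : ℝ) < k := by positivity
  have hm0 : (0 : ℝ) < m := by positivity
  have hGint : Integrable G P := integrable_comp_subsamples hS hk fun s =>
    ∑ p ∈ (Finset.univ : Finset (Fin m)).offDiag, overlapKernel k N (s p.1) (s p.2)
  have hG2int : Integrable (fun ω => G ω ^ 2) P := integrable_comp_subsamples hS hk fun s =>
    (∑ p ∈ (Finset.univ : Finset (Fin m)).offDiag, overlapKernel k N (s p.1) (s p.2)) ^ 2
  have h1 : ∫ ω, G ω ^ 2 ∂P ≤ 2 * (m ^ 2 * (k ^ 2 / N)) := by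
    refine (integral_sq_sum_offDiag_le hind (fun j => (hS j).measurable.aemeasurable)
      (f := fun _ _ => overlapKernel k N) (fun _ _ => .of_discrete) Finset.univ
      (fun i _ _ y => integral_overlapKernel (hS i) (by omega) hk y)
      (fun j _ _ x => by
        simp_rw [overlapKernel_comm k N x]
        exact integral_overlapKernel (hS j) (by omega) hk x)
      (fun p _ => memLp_comp_of_ae_mem_finset (measurable_subsamples hS).aemeasurable
        (ae_forall_mem hS hk) (fun s => overlapKernel k N (s p.1) (s p.2)) 2)).trans ?_
    have h2 : ∀ p ∈ (Finset.univ : Finset (Fin m)).offDiag,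
        ∫ ω, overlapKernel k N (S p.1 ω) (S p.2 ω) ^ 2 ∂P ≤ (k : ℝ) ^ 2 / N := fun p hp =>
      integral_overlapKernel_sq_le (hS _) (hS _) (hind.indepFun (Finset.mem_offDiag.1 hp).2.2)
        hk2 hk
    have h3 := Finset.sum_le_sum h2
    rw [Finset.sum_const, Finset.offDiag_card, Finset.card_univ, Fintype.card_fin,
      nsmul_eq_mul] at h3
    have h4 : ((m * m - m : ℕ) : ℝ) ≤ m ^ 2 := by
      rw [sq]; exact_mod_cast Nat.sub_le _ _
    have h5 := mul_le_mul_of_nonneg_right h4 (show (0 : ℝ) ≤ (k : ℝ) ^ 2 / N by positivity)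
    linarith
  -- In place of Cauchy–Schwarz: `|G| ≤ (c + G² / c) / 2` gives `E|G| ≤ c` for every `c > 0` with `E
  -- G² ≤ c²`. Here `c²` is twice the bound just obtained.
  set c : ℝ := 2 * (m * k) / √N with hc
  have hc0 : 0 < c := by positivity
  have hc2 : c ^ 2 = 4 * (m ^ 2 * (k ^ 2 / N)) := by
    rw [hc, div_pow, Real.sq_sqrt hN.le]; ring
  clear_value c
  have h2 : ∫ ω, |G ω| ∂P ≤ ∫ ω, (c + G ω ^ 2 / c) / 2 ∂P := by
    refine integral_mono hGint.abs (((integrable_const _).add (hG2int.div_const _)).div_const _)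
      fun ω => ?_
    have h3 : c * |G ω| ≤ c * ((c + G ω ^ 2 / c) / 2) := by
      have e : c * ((c + G ω ^ 2 / c) / 2) = (c ^ 2 + G ω ^ 2) / 2 := by field_simp
      rw [e, ← sq_abs (G ω)]
      nlinarith [sq_nonneg (c - |G ω|)]
    exact le_of_mul_le_mul_left h3 hc0
  refine h2.trans ?_
  have h4 : ∫ ω, (c + G ω ^ 2 / c) ∂P = c + (∫ ω, G ω ^ 2 ∂P) / c := by
    rw [integral_add (integrable_const _) (hG2int.div_const _), integral_div]
    simp
  rw [integral_div, h4]
  have h3 : (∫ ω, G ω ^ 2 ∂P) / c ≤ c := by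
    rw [div_le_iff₀ hc0, ← sq, hc2]
    have : 0 ≤ (m : ℝ) ^ 2 * (k ^ 2 / N) := by positivity
    linarith
  linarith

end Subsamples

end Subbagging

end

namespace Subbagging

/-! ### Weighted sums of iid data, with fixed and random weights -/

section WeightedSums

variable {Ω α τ : Type*} [MeasurableSpace Ω] [MeasurableSpace α] [MeasurableSpace τ]
  {P : Measure Ω} {F : Measure α} {Z : ℕ → Ω → α}

lemma integral_comp_of_hasLaw (hZlaw : ∀ i, HasLaw (Z i) F P) {f : α → ℝ} (hf : Measurable f)
    (i : ℕ) : ∫ ω, f (Z i ω) ∂P = ∫ z, f z ∂F :=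
  (hZlaw i).integral_comp hf.aestronglyMeasurable

lemma memLp_comp_of_hasLaw (hZlaw : ∀ i, HasLaw (Z i) F P) {f : α → ℝ} {p : ℝ≥0∞}
    (hf : MemLp f p F) (i : ℕ) : MemLp (fun ω => f (Z i ω)) p P := by
  have h := hf
  rw [← (hZlaw i).map_eq] at h
  exact h.comp_of_map (hZlaw i).aemeasurable

lemma integral_exp_sum_mul_I (hZlaw : ∀ i, HasLaw (Z i) F P) (hZ : iIndepFun Z P)
    {Y : α → ℝ} (hY : Measurable Y) (N : ℕ) (c : ℕ → ℝ) :
    ∫ ω, Complex.exp ((∑ i ∈ Finset.range N, c i * Y (Z i ω) : ℝ) * Complex.I) ∂P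
      = ∏ i ∈ Finset.range N, charFun (F.map Y) (c i) := by
  have hm : ∀ i, AEMeasurable (fun ω => c i * Y (Z i ω)) P := fun i =>
    (hY.comp_aemeasurable (hZlaw i).aemeasurable).const_mul _
  have hind : iIndepFun (fun i ω => c i * Y (Z i ω)) P :=
    hZ.comp (fun i z => c i * Y z) fun i => hY.const_mul _
  have h1 := congrFun (iIndepFun.charFun_map_fun_finsetSum_eq_prod (s := Finset.range N)
    (fun i _ => hm i) (hind.restrict _)) 1
  rw [charFun_apply_real, integral_map (Finset.aemeasurable_fun_sum _ fun i _ => hm i)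
    (by fun_prop)] at h1
  have h2 : ∀ i, charFun (P.map fun ω => c i * Y (Z i ω)) 1 = charFun (F.map Y) (c i) := by
    intro i
    rw [charFun_map_mul_comp, mul_one]
    · congr 1
      have := AEMeasurable.map_map_of_aemeasurable (μ := P) (f := Z i) (g := Y)
        hY.aemeasurable (hZlaw i).aemeasurable
      rw [(hZlaw i).map_eq] at this
      exact this.symm
    · exact hY.comp_aemeasurable (hZlaw i).aemeasurable
  simp only [Complex.ofReal_one, one_mul, Finset.prod_apply, h2] at h1
  exact h1

lemma memLp_two_mul_comp (hZlaw : ∀ i, HasLaw (Z i) F P) (hZ : iIndepFun Z P)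
    {a b : α → ℝ} (ha : Measurable a) (hb : Measurable b) (ha2 : MemLp a 2 F) (hb2 : MemLp b 2 F)
    {i j : ℕ} (hij : i ≠ j) :
    MemLp (fun ω => a (Z i ω) * b (Z j ω)) 2 P ∧
    ∫ ω, (a (Z i ω) * b (Z j ω)) ^ 2 ∂P = (∫ z, a z ^ 2 ∂F) * ∫ z, b z ^ 2 ∂F := by
  have h1 := memLp_comp_of_hasLaw hZlaw ha2 i
  have h2 := memLp_comp_of_hasLaw hZlaw hb2 j
  have hind : IndepFun (fun ω => a (Z i ω) ^ 2) (fun ω => b (Z j ω) ^ 2) P :=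
    (hZ.indepFun hij).comp (φ := fun z => a z ^ 2) (ψ := fun z => b z ^ 2)
      (ha.pow_const 2) (hb.pow_const 2)
  constructor
  · refine (memLp_two_iff_integrable_sq
      (h1.aestronglyMeasurable.mul h2.aestronglyMeasurable)).2 ?_
    simp_rw [Pi.mul_apply, mul_pow]
    exact hind.integrable_mul h1.integrable_sq h2.integrable_sq
  · simp_rw [mul_pow]
    rw [hind.integral_fun_mul_eq_mul_integral h1.integrable_sq.aestronglyMeasurable
      h2.integrable_sq.aestronglyMeasurable,
      integral_comp_of_hasLaw hZlaw (f := fun z => a z ^ 2) (ha.pow_const 2),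
      integral_comp_of_hasLaw hZlaw (f := fun z => b z ^ 2) (hb.pow_const 2)]

variable [IsProbabilityMeasure P] [Countable τ] [MeasurableSingletonClass τ] {T : Ω → τ}

/-- Conditioning on `T`: the weights are frozen by independence, after which the characteristic
function factorises over the data. -/
lemma integral_exp_sum_random_mul_I (hZlaw : ∀ i, HasLaw (Z i) F P) (hZ : iIndepFun Z P)
    {Y : α → ℝ} (hY : Measurable Y) (N : ℕ) (hT : AEMeasurable T P)
    (hZT : IndepFun (fun ω (i : Fin N) => Z i ω) T P) (c : ℕ → τ → ℝ) :
    ∫ ω, Complex.exp ((∑ i ∈ Finset.range N, c i (T ω) * Y (Z i ω) : ℝ) * Complex.I) ∂P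
      = ∫ ω, ∏ i ∈ Finset.range N, charFun (F.map Y) (c i (T ω)) ∂P := by
  let f : (Fin N → α) × τ → ℂ := fun z =>
    Complex.exp ((∑ i : Fin N, c i z.2 * Y (z.1 i) : ℝ) * Complex.I)
  have hf : Measurable f := by
    refine measurable_from_prod_countable_left fun y => ?_
    have : Measurable fun x : Fin N → α => ∑ i : Fin N, c i y * Y (x i) :=
      Finset.measurable_sum _ fun i _ => (hY.comp (measurable_pi_apply i)).const_mul _
    fun_prop
  have hX : AEMeasurable (fun ω (i : Fin N) => Z i ω) P :=
    aemeasurable_pi_lambda _ fun i => (hZlaw i).aemeasurable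
  have key := integral_comp_prodMk_of_indepFun hZT hX hT hf.stronglyMeasurable
    (Integrable.of_bound (C := 1) (hf.comp_aemeasurable (hX.prodMk hT)).aestronglyMeasurable
      (.of_forall fun ω => (Complex.norm_exp_ofReal_mul_I _).le))
  simp only [f] at key
  simp_rw [Finset.sum_range]
  rw [key]
  refine integral_congr_ae (.of_forall fun ω => ?_)
  have := integral_exp_sum_mul_I hZlaw hZ hY N fun i => c i (T ω)
  simp_rw [Finset.sum_range] at this
  exact this

lemma integral_sq_sum_offDiag_mul_le (hZlaw : ∀ i, HasLaw (Z i) F P) (hZ : iIndepFun Z P)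
    {a b : α → ℝ} (ha : Measurable a) (hb : Measurable b) (ha2 : MemLp a 2 F) (hb2 : MemLp b 2 F)
    (ha0 : ∫ z, a z ∂F = 0) (hb0 : ∫ z, b z ∂F = 0) (s : Finset ℕ) (w : ℕ × ℕ → ℝ) :
    Integrable (fun ω => (∑ p ∈ s.offDiag, w p * (a (Z p.1 ω) * b (Z p.2 ω))) ^ 2) P ∧
    ∫ ω, (∑ p ∈ s.offDiag, w p * (a (Z p.1 ω) * b (Z p.2 ω))) ^ 2 ∂P
      ≤ 2 * ((∫ z, a z ^ 2 ∂F) * ∫ z, b z ^ 2 ∂F) * ∑ p ∈ s.offDiag, w p ^ 2 := by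
  have hL : ∀ p ∈ s.offDiag, MemLp (fun ω => w p * (a (Z p.1 ω) * b (Z p.2 ω))) 2 P :=
    fun p hp => (memLp_two_mul_comp hZlaw hZ ha hb ha2 hb2
      (Finset.mem_offDiag.1 hp).2.2).1.const_mul _
  refine ⟨(memLp_finsetSum _ hL).integrable_sq, ?_⟩
  have h := integral_sq_sum_offDiag_le hZ (fun i => (hZlaw i).aemeasurable)
    (f := fun i j x y => w (i, j) * (a x * b y))
    (fun i j => by
      simp only [Function.uncurry_def]
      exact ((ha.comp measurable_fst).mul (hb.comp measurable_snd)).const_mul _) s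
    (fun i _ j y => by
      rw [integral_const_mul, integral_mul_const, integral_comp_of_hasLaw hZlaw ha, ha0]; simp)
    (fun j _ i x => by
      rw [integral_const_mul, integral_const_mul, integral_comp_of_hasLaw hZlaw hb, hb0]; simp)
    hL
  refine h.trans (le_of_eq ?_)
  rw [mul_assoc]
  congr 1
  rw [Finset.mul_sum]
  refine Finset.sum_congr rfl fun p hp => ?_
  have := (memLp_two_mul_comp hZlaw hZ ha hb ha2 hb2 (Finset.mem_offDiag.1 hp).2.2).2
  simp only [mul_pow (w _)]
  rw [integral_const_mul, this, mul_comm]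

/-- Freeze the weights, apply the bound for fixed weights, then average over `T`. In terms of `∫⁻`,
no integrability of the square under the joint law has to be known beforehand. -/
lemma lintegral_sq_sum_offDiag_random_le (hZlaw : ∀ i, HasLaw (Z i) F P) (hZ : iIndepFun Z P)
    {a b : α → ℝ} (ha : Measurable a) (hb : Measurable b) (ha2 : MemLp a 2 F) (hb2 : MemLp b 2 F)
    (ha0 : ∫ z, a z ∂F = 0) (hb0 : ∫ z, b z ∂F = 0) (N : ℕ) (hT : AEMeasurable T P)
    (hZT : IndepFun (fun ω (i : Fin N) => Z i ω) T P) (w : ℕ × ℕ → τ → ℝ)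
    (hw : Integrable (fun ω => ∑ p ∈ (Finset.range N).offDiag, w p (T ω) ^ 2) P) :
    ∫⁻ ω, ENNReal.ofReal ((∑ p ∈ (Finset.range N).offDiag,
        w p (T ω) * (a (Z p.1 ω) * b (Z p.2 ω))) ^ 2) ∂P
      ≤ ENNReal.ofReal (2 * ((∫ z, a z ^ 2 ∂F) * ∫ z, b z ^ 2 ∂F) *
        ∫ ω, ∑ p ∈ (Finset.range N).offDiag, w p (T ω) ^ 2 ∂P) := by
  -- Independence from `T` concerns the first `N` observations only, while the sum is indexed by
  -- `ℕ`. The default 0 is never reached, as all indices in the sum lie below `N`.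
  let e : ℕ → (Fin N → α) → (α → ℝ) → ℝ := fun i x g => if h : i < N then g (x ⟨i, h⟩) else 0
  have he : ∀ i (g : α → ℝ), Measurable g → Measurable fun x => e i x g := fun i g hg => by
    by_cases h : i < N
    · simp only [e, h, dite_true]
      exact hg.comp (measurable_pi_apply _)
    · simp only [e, h, dite_false]
      exact measurable_const
  let f : (Fin N → α) × τ → ℝ≥0∞ := fun z => ENNReal.ofReal ((∑ p ∈ (Finset.range N).offDiag,
        w p z.2 * (e p.1 z.1 a * e p.2 z.1 b)) ^ 2)
  have hf : Measurable f := by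
    refine measurable_from_prod_countable_left fun y => ENNReal.measurable_ofReal.comp ?_
    exact (Finset.measurable_sum (Finset.range N).offDiag fun p _ =>
      ((he p.1 _ ha).mul (he p.2 _ hb)).const_mul (w p y)).pow_const 2
  have hX : AEMeasurable (fun ω (i : Fin N) => Z i ω) P :=
    aemeasurable_pi_lambda _ fun i => (hZlaw i).aemeasurable
  have hfe : ∀ ω y, f ((fun i : Fin N => Z i ω), y) = ENNReal.ofReal
      ((∑ p ∈ (Finset.range N).offDiag, w p y * (a (Z p.1 ω) * b (Z p.2 ω))) ^ 2) := by
    intro ω y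
    simp only [f, e]
    congr 2
    refine Finset.sum_congr rfl fun p hp => ?_
    rw [Finset.mem_offDiag, Finset.mem_range, Finset.mem_range] at hp
    simp [hp.1, hp.2.1]
  have key := lintegral_comp_prodMk_of_indepFun hZT hX hT hf
  simp only [hfe] at key
  rw [key, ← integral_const_mul, ofReal_integral_eq_lintegral_ofReal (hw.const_mul _)
    (.of_forall fun ω => by
      have h1 : 0 ≤ ∫ z, a z ^ 2 ∂F := integral_nonneg fun z => sq_nonneg _
      have h2 : 0 ≤ ∫ z, b z ^ 2 ∂F := integral_nonneg fun z => sq_nonneg _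
      have h3 : 0 ≤ ∑ p ∈ (Finset.range N).offDiag, w p (T ω) ^ 2 :=
        Finset.sum_nonneg fun _ _ => sq_nonneg _
      simp only [Pi.zero_apply]
      positivity)]
  refine lintegral_mono fun ω => ?_
  obtain ⟨h1, h2⟩ := integral_sq_sum_offDiag_mul_le hZlaw hZ ha hb ha2 hb2 ha0 hb0
    (Finset.range N) fun p => w p (T ω)
  rw [← ofReal_integral_eq_lintegral_ofReal h1 (.of_forall fun ω => sq_nonneg _)]
  exact ENNReal.ofReal_le_ofReal h2

end WeightedSums

/-! ### Characteristic function of the leading term -/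

section CharFun

variable {Ω α : Type*} [MeasurableSpace Ω] [MeasurableSpace α]
  {P : Measure Ω} [IsProbabilityMeasure P] {F : Measure α} [IsProbabilityMeasure F]
  {Z : ℕ → Ω → α} {k m N : ℕ} {S : Fin m → Ω → Finset ℕ}

/-- Quantitative central limit theorem, on the level of characteristic functions, for the
sum in which each observation is weighted by the number of subsamples containing it. -/
lemma norm_integral_exp_sum_inclCount_sub_le (hZlaw : ∀ i, HasLaw (Z i) F P) (hZ : iIndepFun Z P)
    {Y : α → ℝ} (hY : Measurable Y) (hS : ∀ j, IsUniformSubset P k N (S j))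
    (hind : iIndepFun S P) (hZS : IndepFun (fun ω (i : Fin N) => Z i ω) (fun ω j => S j ω) P)
    (hk2 : 2 ≤ k) (hk : k ≤ N) (hm : 0 < m) {C q : ℝ} (hC0 : 0 ≤ C) (hq : 0 ≤ q)
    (hC : ∀ t : ℝ, ‖charFun (F.map Y) t - (Real.exp (-(q / 2 * t ^ 2)) : ℝ)‖ ≤ C * |t| ^ 3)
    {r : ℝ} (hr : 0 ≤ r) :
    ‖∫ ω, Complex.exp ((∑ i ∈ Finset.range N,
        r * (inclCount (fun j => S j ω) i / (m * k)) * Y (Z i ω) : ℝ) * Complex.I) ∂P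
        - (Real.exp (-(q / 2)) : ℝ)‖
      ≤ C * ((r / (m * k)) ^ 3 *
          (N * (m * (k / N) + 3 * m ^ 2 * (k / N) ^ 2 + m ^ 3 * (k / N) ^ 3)))
        + q / 2 * (|r ^ 2 * ((1 - k / N) / (m * k) + 1 / N) - 1|
          + r ^ 2 / (m * k) ^ 2 * (2 * (m * k) / √N)) := by
  have hm0 : (0 : ℝ) < m := by exact_mod_cast hm
  have hk0 : (0 : ℝ) < k := by exact_mod_cast (by omega : 0 < k)
  have hN0 : (0 : ℝ) < N := by exact_mod_cast (by omega : 0 < N)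
  have : IsProbabilityMeasure (F.map Y) := Measure.isProbabilityMeasure_map hY.aemeasurable
  rw [integral_exp_sum_random_mul_I hZlaw hZ hY N (measurable_subsamples hS).aemeasurable hZS
    fun i s => r * (inclCount s i / (m * k))]
  set D := r / (m * k : ℝ) with hD
  have hD0 : 0 ≤ D := by positivity
  have e0 : ∀ (s : Fin m → Finset ℕ) i, r * (inclCount s i / (m * k)) = D * inclCount s i :=
    fun s i => by rw [hD]; ring
  simp_rw [e0]
  set φ := charFun (F.map Y)
  let A : (Fin m → Finset ℕ) → ℂ := fun s => ∏ i ∈ Finset.range N, φ (D * inclCount s i)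
  let B : (Fin m → Finset ℕ) → ℝ := fun s => ∑ i ∈ Finset.range N, inclCount s i ^ 3
  let Q : (Fin m → Finset ℕ) → ℝ := fun s => ∑ i ∈ Finset.range N, inclCount s i ^ 2
  let G : (Fin m → Finset ℕ) → ℝ := fun s =>
    ∑ p ∈ (Finset.univ : Finset (Fin m)).offDiag, overlapKernel k N (s p.1) (s p.2)
  set v : ℝ := r ^ 2 * ((1 - k / N) / (m * k) + 1 / N) with hv
  have hAint : Integrable (fun ω => A fun j => S j ω) P := integrable_comp_of_ae_mem_finset
    (measurable_subsamples hS).aemeasurable (ae_forall_mem hS hk) A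
  have hBint : Integrable (fun ω => B fun j => S j ω) P := integrable_comp_subsamples hS hk B
  have hGint : Integrable (fun ω => |G fun j => S j ω|) P :=
    (integrable_comp_subsamples hS hk G).abs
  -- For given subsamples there are two errors: the factors are replaced by Gaussian ones, which
  -- costs the cubes, and the realised variance `D ^ 2 * Q` is replaced by 1.
  have hpt : ∀ᵐ ω ∂P, ‖A (fun j => S j ω) - (Real.exp (-(q / 2)) : ℝ)‖
      ≤ C * (D ^ 3 * B fun j => S j ω) + q / 2 * (|v - 1| + D ^ 2 * |G fun j => S j ω|) := by
    filter_upwards [ae_forall_mem hS hk] with ω hω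
    set s : Fin m → Finset ℕ := fun j => S j ω
    have hs := Fintype.mem_piFinset.1 hω
    have h1 : ‖A s - (Real.exp (-(q / 2 * (D ^ 2 * Q s))) : ℝ)‖ ≤ C * (D ^ 3 * B s) := by
      have e1 : ((Real.exp (-(q / 2 * (D ^ 2 * Q s))) : ℝ) : ℂ)
          = ∏ i ∈ Finset.range N, ((Real.exp (-(q / 2 * (D * inclCount s i) ^ 2)) : ℝ) : ℂ) := by
        rw [← Complex.ofReal_prod, ← Real.exp_sum]
        congr 2
        simp only [Q, Finset.mul_sum, ← Finset.sum_neg_distrib]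
        exact Finset.sum_congr rfl fun i _ => by ring
      rw [e1]
      refine (norm_prod_sub_prod_le_sum _ _ _ (fun i _ => norm_charFun_le_one _)
        fun i _ => ?_).trans ?_
      · rw [Complex.norm_real, Real.norm_of_nonneg (Real.exp_pos _).le]
        exact Real.exp_le_one_iff.2 (by have := sq_nonneg (D * inclCount s i); nlinarith)
      · simp only [B, Finset.mul_sum]
        refine Finset.sum_le_sum fun i _ => (hC _).trans (le_of_eq ?_)
        rw [abs_of_nonneg (mul_nonneg hD0 (inclCount_nonneg _ _)), mul_pow]
    -- Deterministic deviation of the expected variance from 1, plus the degenerate fluctuation due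
    -- to the choice of subsamples.
    have hQ : D ^ 2 * Q s - 1 = (v - 1) + D ^ 2 * G s := by
      have := sum_inclCount_sq_eq (by omega) hk hs
      simp only [Q, G]
      rw [this, hv, hD]
      field_simp
      ring
    have hQ0 : 0 ≤ D ^ 2 * Q s :=
      mul_nonneg (sq_nonneg _) (Finset.sum_nonneg fun _ _ => sq_nonneg _)
    have h2 : ‖((Real.exp (-(q / 2 * (D ^ 2 * Q s))) : ℝ) : ℂ) - (Real.exp (-(q / 2)) : ℝ)‖
        ≤ q / 2 * (|v - 1| + D ^ 2 * |G s|) := by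
      rw [← Complex.ofReal_sub, Complex.norm_real, Real.norm_eq_abs]
      refine (abs_exp_neg_sub_exp_neg_le (by positivity) (by positivity)).trans ?_
      have e2 : q / 2 * (D ^ 2 * Q s) - q / 2 = q / 2 * ((v - 1) + D ^ 2 * G s) := by
        rw [← hQ]; ring
      rw [e2, abs_mul, abs_of_nonneg (by positivity : (0 : ℝ) ≤ q / 2)]
      gcongr
      refine (abs_add_le _ _).trans ?_
      rw [abs_mul, abs_of_nonneg (sq_nonneg D)]
    calc _ = ‖(A s - (Real.exp (-(q / 2 * (D ^ 2 * Q s))) : ℝ))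
          + (((Real.exp (-(q / 2 * (D ^ 2 * Q s))) : ℝ) : ℂ) - (Real.exp (-(q / 2)) : ℝ))‖ := by
          congr 1; ring
      _ ≤ _ := (norm_add_le _ _).trans (add_le_add h1 h2)
  have e3 : ∫ ω, A (fun j => S j ω) ∂P - (Real.exp (-(q / 2)) : ℝ)
      = ∫ ω, (A (fun j => S j ω) - (Real.exp (-(q / 2)) : ℝ)) ∂P := by
    rw [integral_sub hAint (integrable_const _)]
    simp
  have i1 : Integrable (fun ω => C * (D ^ 3 * B fun j => S j ω)) P :=
    (hBint.const_mul _).const_mul _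
  have i2 : Integrable (fun ω => |v - 1| + D ^ 2 * |G fun j => S j ω|) P :=
    (integrable_const _).add (hGint.const_mul _)
  have e4 : ∫ ω, (|v - 1| + D ^ 2 * |G fun j => S j ω|) ∂P
      = |v - 1| + D ^ 2 * ∫ ω, |G fun j => S j ω| ∂P := by
    rw [integral_add (integrable_const _) (hGint.const_mul _), integral_const_mul]
    simp
  have h5 := integral_sum_inclCount_cube_le hS hind (by omega) hk
  have h6 := integral_abs_sum_overlapKernel_le hS hind hk2 hk hm
  calc _ = ‖∫ ω, (A (fun j => S j ω) - (Real.exp (-(q / 2)) : ℝ)) ∂P‖ := by rw [← e3]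
    _ ≤ ∫ ω, (C * (D ^ 3 * B fun j => S j ω)
          + q / 2 * (|v - 1| + D ^ 2 * |G fun j => S j ω|)) ∂P :=
        (norm_integral_le_integral_norm _).trans
          (integral_mono_ae (hAint.sub (integrable_const _)).norm (i1.add (i2.const_mul _)) hpt)
    _ = C * (D ^ 3 * ∫ ω, B fun j => S j ω ∂P)
          + q / 2 * (|v - 1| + D ^ 2 * ∫ ω, |G fun j => S j ω| ∂P) := by
        rw [integral_add i1 (i2.const_mul _), integral_const_mul, integral_const_mul,
          integral_const_mul, e4]
    _ ≤ _ := by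
        rw [← div_pow]
        gcongr

end CharFun

end Subbagging

noncomputable section

namespace Subbagging

/-! ### Exact decomposition of the estimation error -/

section Decomposition

variable {p : ℕ}

/-- The influence function `(z - μ₀, vech((z - μ₀)(z - μ₀)ᵀ - Σ₀))` of the estimator. -/
def influence (F : Measure (EuclideanSpace ℝ (Fin p))) (z : EuclideanSpace ℝ (Fin p)) :
    EuclideanSpace ℝ (ParamIdx p) :=
  stack (z - mean F) (outer F z - covMat F)

/-- The second-order (completely degenerate) part of the subbagging covariance estimator. -/
def remainder (F : Measure (EuclideanSpace ℝ (Fin p))) (k N : ℕ) {m : ℕ}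
    (z : ℕ → EuclideanSpace ℝ (Fin p)) (S : Fin m → Finset ℕ) : Matrix (Fin p) (Fin p) ℝ :=
  Matrix.of fun a b => ∑ i ∈ (Finset.range N).offDiag,
    (∑ j, incl (S j) i.1 * incl (S j) i.2) / (m * (k * (k - 1))) *
      (centred F (z i.1) a * centred F (z i.2) b)

lemma sum_inclCount_mul {k N m : ℕ} {S : Fin m → Finset ℕ}
    (hS : ∀ j, S j ∈ Finset.powersetCard k (Finset.range N)) (f : ℕ → ℝ) :
    ∑ i ∈ Finset.range N, inclCount S i * f i = ∑ j, ∑ i ∈ S j, f i := by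
  simp_rw [inclCount, Finset.sum_mul]
  rw [Finset.sum_comm]
  exact Finset.sum_congr rfl fun j _ => sum_range_incl_smul (hS j) f

lemma sum_pairCount_mul {k N m : ℕ} {S : Fin m → Finset ℕ}
    (hS : ∀ j, S j ∈ Finset.powersetCard k (Finset.range N)) (f : ℕ × ℕ → ℝ) :
    ∑ i ∈ (Finset.range N).offDiag, (∑ j, incl (S j) i.1 * incl (S j) i.2) * f i
      = ∑ j, ∑ i ∈ (S j).offDiag, f i := by
  simp_rw [Finset.sum_mul]
  rw [Finset.sum_comm]
  refine Finset.sum_congr rfl fun j _ => ?_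
  have hsub : (S j).offDiag ⊆ (Finset.range N).offDiag :=
    Finset.offDiag_mono (Finset.mem_powersetCard.1 (hS j)).1
  rw [← Finset.sum_subset hsub]
  · refine Finset.sum_congr rfl fun i hi => ?_
    rw [Finset.mem_offDiag] at hi
    simp [incl, hi.1, hi.2.1]
  · intro i hi hi'
    rw [Finset.mem_offDiag] at hi hi'
    have : incl (S j) i.1 * incl (S j) i.2 = 0 := by
      unfold incl
      split_ifs <;> simp_all
    rw [this, zero_mul]

lemma sum_mul_sum_eq_add_offDiag (s : Finset ℕ) (x y : ℕ → ℝ) :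
    (∑ i ∈ s, x i) * ∑ i ∈ s, y i
      = ∑ i ∈ s, x i * y i + ∑ i ∈ s.offDiag, x i.1 * y i.2 := by
  rw [Finset.sum_mul_sum, ← Finset.sum_product', ← Finset.diag_union_offDiag,
    Finset.sum_union (Finset.disjoint_diag_offDiag _), Finset.sum_diag]

variable (F : Measure (EuclideanSpace ℝ (Fin p)))

lemma subsampleMean_apply (k : ℕ) (z : ℕ → EuclideanSpace ℝ (Fin p)) (s : Finset ℕ) (a : Fin p) :
    subsampleMean k z s a = (k : ℝ)⁻¹ * ∑ i ∈ s, z i a := by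
  simp [subsampleMean]

lemma subsampleMean_sub_mean {k : ℕ} (hk : k ≠ 0) (z : ℕ → EuclideanSpace ℝ (Fin p))
    {s : Finset ℕ} (hs : s.card = k) (a : Fin p) :
    subsampleMean k z s a - mean F a = (∑ i ∈ s, centred F (z i) a) / k := by
  have hk' : (k : ℝ) ≠ 0 := by exact_mod_cast hk
  rw [subsampleMean_apply]
  simp only [centred, Finset.sum_sub_distrib, Finset.sum_const, hs, nsmul_eq_mul]
  field_simp

/-- Recentring at the true mean leaves `(∑ x y - (∑ x)(∑ y) / k) / (k - 1)`. Splitting off the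
diagonal of the product gives it the coefficient `(1 - 1/k) / (k - 1) = 1 / k`, so the bias
correction leaves a purely off-diagonal second term. -/
lemma subsampleCov_apply {k : ℕ} (hk : 2 ≤ k) (z : ℕ → EuclideanSpace ℝ (Fin p))
    {s : Finset ℕ} (hs : s.card = k) (a b : Fin p) :
    subsampleCov k z s a b = (∑ i ∈ s, centred F (z i) a * centred F (z i) b) / k
      - (∑ i ∈ s.offDiag, centred F (z i.1) a * centred F (z i.2) b) / (k * (k - 1)) := by
  have hk0 : (k : ℝ) ≠ 0 := by exact_mod_cast (by omega : k ≠ 0)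
  have hk1 : (k : ℝ) - 1 ≠ 0 := by
    have : (2 : ℝ) ≤ k := by exact_mod_cast hk
    linarith
  set X : ℝ := ∑ i ∈ s, centred F (z i) a with hX
  set Y : ℝ := ∑ i ∈ s, centred F (z i) b with hY
  have hdiff : ∀ i c, (z i - subsampleMean k z s) c
      = centred F (z i) c - (∑ i ∈ s, centred F (z i) c) / k := fun i c => by
    rw [← subsampleMean_sub_mean F (by omega) z hs c]
    simp [centred]
  have h1 : subsampleCov k z s a b = ((k : ℝ) - 1)⁻¹ * ∑ i ∈ s,
      (centred F (z i) a - X / k) * (centred F (z i) b - Y / k) := by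
    simp only [subsampleCov, Matrix.smul_apply, Matrix.sum_apply, vecMulVec_apply, hdiff,
      smul_eq_mul, hX, hY]
  have h2 : ∑ i ∈ s, (centred F (z i) a - X / k) * (centred F (z i) b - Y / k)
      = ∑ i ∈ s, centred F (z i) a * centred F (z i) b - X * Y / k := by
    have e : ∀ i, (centred F (z i) a - X / k) * (centred F (z i) b - Y / k)
        = centred F (z i) a * centred F (z i) b - Y / k * centred F (z i) a
          - X / k * centred F (z i) b + X / k * (Y / k) := fun i => by ring
    simp_rw [e, Finset.sum_add_distrib, Finset.sum_sub_distrib, ← Finset.mul_sum, ← hX, ← hY,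
      Finset.sum_const, hs, nsmul_eq_mul]
    field_simp
    ring
  have h3 := sum_mul_sum_eq_add_offDiag s (fun i => centred F (z i) a) (fun i => centred F (z i) b)
  rw [← hX, ← hY] at h3
  rw [h1, h2, h3]
  field_simp
  ring

/-- The estimation error is a weighted sum of influence functions minus a degenerate remainder. -/
lemma subbagEstimator_sub_trueParam {k m N : ℕ} (hk : 2 ≤ k) (hm : m ≠ 0)
    (z : ℕ → EuclideanSpace ℝ (Fin p)) {S : Fin m → Finset ℕ}
    (hS : ∀ j, S j ∈ Finset.powersetCard k (Finset.range N)) :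
    subbagEstimator k m z S - trueParam F
      = ∑ i ∈ Finset.range N, (inclCount S i / (m * k)) • influence F (z i)
        - stack 0 (remainder F k N z S) := by
  have hk0 : (k : ℝ) ≠ 0 := by exact_mod_cast (by omega : k ≠ 0)
  have hk1 : (k : ℝ) - 1 ≠ 0 := by
    have : (2 : ℝ) ≤ k := by exact_mod_cast hk
    linarith
  have hm0 : (m : ℝ) ≠ 0 := by exact_mod_cast hm
  have hcard : ∀ j, (S j).card = k := fun j => (Finset.mem_powersetCard.1 (hS j)).2
  have hdiv : ∀ f : ℕ → ℝ, ∑ i ∈ Finset.range N, inclCount S i / (m * k) * f i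
      = (m : ℝ)⁻¹ * ∑ j, (∑ i ∈ S j, f i) / k := fun f => by
    rw [← Finset.sum_div, ← sum_inclCount_mul hS f, Finset.sum_div, Finset.mul_sum]
    exact Finset.sum_congr rfl fun i _ => by field_simp
  ext q
  rcases q with a | ⟨⟨a, b⟩, hab⟩
  · have h1 : (m : ℝ)⁻¹ * ∑ j, (∑ i ∈ S j, centred F (z i) a) / k
        = (m : ℝ)⁻¹ * ∑ j, subsampleMean k z (S j) a - mean F a := by
      simp_rw [← subsampleMean_sub_mean F (by omega) z (hcard _) a]
      rw [Finset.sum_sub_distrib]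
      simp only [Finset.sum_const, Finset.card_univ, Fintype.card_fin, nsmul_eq_mul]
      field_simp
    have h2 := hdiv fun i => centred F (z i) a
    simp only [subbagEstimator, trueParam, influence, stack, subbagMean, PiLp.sub_apply,
      Sum.elim_inl, WithLp.ofLp_sum, WithLp.ofLp_smul, Finset.sum_apply, Pi.smul_apply,
      smul_eq_mul, PiLp.smul_apply, PiLp.zero_apply, sub_zero]
    rw [← h1, ← h2]
    rfl
  -- The index `(a, b)` is (column, row), so `vech` reads the matrix entry `b a`; hence the order of
  -- the factors throughout this case.
  · have h1 : (m : ℝ)⁻¹ * ∑ j, (∑ i ∈ S j,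
          (centred F (z i) b * centred F (z i) a - covMat F b a)) / k
        = (m : ℝ)⁻¹ * ∑ j, (∑ i ∈ S j, centred F (z i) b * centred F (z i) a) / k
          - covMat F b a := by
      simp_rw [Finset.sum_sub_distrib, Finset.sum_const, hcard, nsmul_eq_mul, sub_div,
        Finset.sum_sub_distrib, mul_div_assoc]
      simp only [Finset.sum_const, Finset.card_univ, Fintype.card_fin, nsmul_eq_mul]
      field_simp
    have h2 := hdiv fun i => centred F (z i) b * centred F (z i) a - covMat F b a
    have h3 : remainder F k N z S b a = (m : ℝ)⁻¹ * ∑ j,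
        (∑ i ∈ (S j).offDiag, centred F (z i.1) b * centred F (z i.2) a) / (k * (k - 1)) := by
      rw [← Finset.sum_div,
        ← sum_pairCount_mul hS fun i => centred F (z i.1) b * centred F (z i.2) a,
        Finset.sum_div, Finset.mul_sum]
      simp only [remainder, Matrix.of_apply]
      exact Finset.sum_congr rfl fun i _ => by field_simp
    have h4 : subbagCov k m z S b a = (m : ℝ)⁻¹ * ∑ j, subsampleCov k z (S j) b a := by
      simp [subbagCov, Matrix.sum_apply]
    simp only [subbagEstimator, trueParam, influence, stack, PiLp.sub_apply, vech,
      Sum.elim_inr, WithLp.ofLp_sum, WithLp.ofLp_smul, Finset.sum_apply, Pi.smul_apply,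
      smul_eq_mul, Matrix.sub_apply]
    rw [h3, h4]
    simp_rw [subsampleCov_apply F hk z (hcard _)]
    rw [Finset.sum_sub_distrib, mul_sub]
    have h5 : ∀ i, outer F (z i) b a = centred F (z i) b * centred F (z i) a := fun i => rfl
    simp_rw [h5]
    rw [h2, h1]
    ring

end Decomposition

/-! ### The influence function and its covariance -/

section AsymptoticCovariance

variable {p : ℕ} {F : Measure (EuclideanSpace ℝ (Fin p))}

lemma measurable_centred (F : Measure (EuclideanSpace ℝ (Fin p))) (a : Fin p) :
    Measurable fun z => centred F z a := by
  unfold centred; fun_prop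

lemma memLp_id_eight (hmom : Integrable (fun z => ‖z‖ ^ 8) F) :
    MemLp (fun z : EuclideanSpace ℝ (Fin p) => z) 8 F := by
  have h := (integrable_norm_rpow_iff (μ := F) (f := fun z : EuclideanSpace ℝ (Fin p) => z)
    (p := 8) (by fun_prop) (by norm_num) (by norm_num)).1
  refine h ?_
  simpa using hmom

variable [IsProbabilityMeasure F]

lemma memLp_centred (hmom : Integrable (fun z => ‖z‖ ^ 8) F) (a : Fin p) :
    MemLp (fun z => centred F z a) 8 F := by
  have h := (memLp_id_eight hmom).continuousLinearMap_comp (EuclideanSpace.proj (𝕜 := ℝ) a)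
  exact h.sub (memLp_const _)

lemma integral_centred (hmom : Integrable (fun z => ‖z‖ ^ 8) F) (a : Fin p) :
    ∫ z, centred F z a ∂F = 0 := by
  have h8 := memLp_id_eight hmom
  have hi : Integrable (fun z : EuclideanSpace ℝ (Fin p) => z) F := h8.integrable (by norm_num)
  have h1 : ∫ z : EuclideanSpace ℝ (Fin p), z a ∂F = mean F a :=
    (EuclideanSpace.proj (𝕜 := ℝ) a).integral_comp_comm hi
  have h2 : Integrable (fun z : EuclideanSpace ℝ (Fin p) => z a) F :=
    (EuclideanSpace.proj (𝕜 := ℝ) a).integrable_comp hi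
  unfold centred
  rw [integral_sub h2 (integrable_const _), h1]
  simp

lemma memLp_centred_mul (hmom : Integrable (fun z => ‖z‖ ^ 8) F) (a b : Fin p) :
    MemLp (fun z => centred F z a * centred F z b) 4 F := by
  have : ENNReal.HolderTriple 8 8 4 := ⟨by
    rw [← two_mul]
    have : (8 : ℝ≥0∞) = 2 * 4 := by norm_num
    rw [this, ENNReal.mul_inv (by simp) (by simp), ← mul_assoc,
      ENNReal.mul_inv_cancel (by simp) (by simp), one_mul]⟩
  exact (memLp_centred hmom b).mul (memLp_centred hmom a)

lemma influence_inl (F : Measure (EuclideanSpace ℝ (Fin p))) (z : EuclideanSpace ℝ (Fin p))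
    (a : Fin p) : influence F z (Sum.inl a) = centred F z a := rfl

lemma influence_inr (F : Measure (EuclideanSpace ℝ (Fin p))) (z : EuclideanSpace ℝ (Fin p))
    (q : VechIdx p) : influence F z (Sum.inr q)
      = centred F z q.1.2 * centred F z q.1.1 - covMat F q.1.2 q.1.1 := rfl

lemma measurable_influence (F : Measure (EuclideanSpace ℝ (Fin p))) :
    Measurable (influence F) := by
  refine (WithLp.measurable_toLp _ _).comp (measurable_pi_lambda _ fun q => ?_)
  rcases q with a | q
  · exact measurable_centred F a
  · exact ((measurable_centred F _).mul (measurable_centred F _)).sub_const _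

lemma memLp_influence (hmom : Integrable (fun z => ‖z‖ ^ 8) F) (q : ParamIdx p) :
    MemLp (fun z => influence F z q) 4 F := by
  rcases q with a | q
  · exact (memLp_centred hmom a).mono_exponent (by norm_num)
  · exact (memLp_centred_mul hmom _ _).sub (memLp_const _)

lemma covMat_apply (F : Measure (EuclideanSpace ℝ (Fin p))) (a b : Fin p) :
    covMat F a b = ∫ z, centred F z a * centred F z b ∂F := rfl

lemma integral_influence (hmom : Integrable (fun z => ‖z‖ ^ 8) F) (q : ParamIdx p) :
    ∫ z, influence F z q ∂F = 0 := by
  rcases q with a | q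
  · exact integral_centred hmom a
  · simp_rw [influence_inr]
    rw [integral_sub ((memLp_centred_mul hmom _ _).integrable (by norm_num)) (integrable_const _),
      ← covMat_apply]
    simp

lemma elimMatrix_mul_apply {n : Type*} (A : Matrix (Fin p × Fin p) n ℝ) (q : VechIdx p) (j : n) :
    (elimMatrix p * A) q j = A q.1 j := by
  simp [Matrix.mul_apply, elimMatrix]

lemma mul_elimMatrix_transpose_apply {n : Type*} (A : Matrix n (Fin p × Fin p) ℝ) (i : n)
    (q : VechIdx p) : (A * (elimMatrix p)ᵀ) i q = A i q.1 := by
  simp [Matrix.mul_apply, elimMatrix]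

/-- The asymptotic covariance matrix is the covariance matrix of the influence function. -/
lemma asympCov_apply (hmom : Integrable (fun z => ‖z‖ ^ 8) F) (i j : ParamIdx p) :
    asympCov F i j = ∫ z, influence F z i * influence F z j ∂F := by
  have hc : ∀ a, Integrable (fun z => centred F z a) F := fun a =>
    (memLp_centred hmom a).integrable (by norm_num)
  have hcc : ∀ a b, Integrable (fun z => centred F z a * centred F z b) F := fun a b =>
    (memLp_centred_mul hmom a b).integrable (by norm_num)
  have hccc : ∀ a b c, Integrable (fun z => centred F z a * centred F z b * centred F z c) F :=
    fun a b c => ((memLp_centred_mul hmom a b).mono_exponent (by norm_num)).integrable_mul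
      (p := 2) (q := 2) ((memLp_centred hmom c).mono_exponent (by norm_num))
  have h4 : ∀ a b c d, Integrable (fun z => (centred F z a * centred F z b)
      * (centred F z c * centred F z d)) F := fun a b c d =>
    ((memLp_centred_mul hmom a b).mono_exponent (by norm_num)).integrable_mul
      (p := 2) (q := 2) ((memLp_centred_mul hmom c d).mono_exponent (by norm_num))
  -- In the mixed blocks, the subtraction of the covariance has no effect because it multiplies a
  -- variable of mean zero.
  have hmix : ∀ a b c, ∫ z, (centred F z a * centred F z b - covMat F a b) * centred F z c ∂F
      = ∫ z, centred F z a * centred F z b * centred F z c ∂F := fun a b c => by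
    simp_rw [sub_mul]
    rw [integral_sub (hccc a b c) ((hc c).const_mul _), integral_const_mul,
      integral_centred hmom c, mul_zero, sub_zero]
  rcases i with a | q <;> rcases j with b | q'
  · rfl
  · simp_rw [influence_inl, influence_inr]
    simp only [asympCov, Matrix.fromBlocks_apply₁₂, Matrix.transpose_apply, elimMatrix_mul_apply]
    simp_rw [mul_comm (centred F _ a), hmix]
    simp only [K3, matExp, Matrix.of_apply, vecMulVec_apply, mul_comm (centred F _ q'.1.2)]
  · simp_rw [influence_inl, influence_inr]
    simp only [asympCov, Matrix.fromBlocks_apply₂₁, elimMatrix_mul_apply]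
    simp_rw [hmix]
    simp only [K3, matExp, Matrix.of_apply, vecMulVec_apply, mul_comm (centred F _ q.1.2)]
  · simp_rw [influence_inr]
    simp only [asympCov, Matrix.fromBlocks_apply₂₂, K4L, mul_elimMatrix_transpose_apply,
      elimMatrix_mul_apply, Matrix.sub_apply, vecMulVec_apply, vec, K4, matExp, Matrix.of_apply,
      outer, Matrix.kroneckerMap_apply]
    have e : ∀ z, (centred F z q.1.2 * centred F z q.1.1 - covMat F q.1.2 q.1.1)
        * (centred F z q'.1.2 * centred F z q'.1.1 - covMat F q'.1.2 q'.1.1)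
        = (centred F z q.1.2 * centred F z q.1.1) * (centred F z q'.1.2 * centred F z q'.1.1)
          - covMat F q'.1.2 q'.1.1 * (centred F z q.1.2 * centred F z q.1.1)
          - covMat F q.1.2 q.1.1 * (centred F z q'.1.2 * centred F z q'.1.1)
          + covMat F q.1.2 q.1.1 * covMat F q'.1.2 q'.1.1 := fun z => by ring
    simp_rw [e]
    have i1 : Integrable (fun z => (centred F z q.1.2 * centred F z q.1.1)
        * (centred F z q'.1.2 * centred F z q'.1.1)
          - covMat F q'.1.2 q'.1.1 * (centred F z q.1.2 * centred F z q.1.1)) F :=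
      (h4 _ _ _ _).sub ((hcc _ _).const_mul _)
    have i2 : Integrable (fun z => (centred F z q.1.2 * centred F z q.1.1)
        * (centred F z q'.1.2 * centred F z q'.1.1)
          - covMat F q'.1.2 q'.1.1 * (centred F z q.1.2 * centred F z q.1.1)
          - covMat F q.1.2 q.1.1 * (centred F z q'.1.2 * centred F z q'.1.1)) F :=
      i1.sub ((hcc _ _).const_mul _)
    rw [integral_add i2 (integrable_const _), integral_sub i1 ((hcc _ _).const_mul _),
      integral_sub (h4 _ _ _ _) ((hcc _ _).const_mul _), integral_const_mul, integral_const_mul,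
      ← covMat_apply, ← covMat_apply]
    -- The Kronecker product pairs the column indices with each other and the row indices with each
    -- other, whereas the influence function pairs row and column of the same entry.
    have e2 : ∫ z, centred F z q.1.1 * centred F z q'.1.1
          * (centred F z q.1.2 * centred F z q'.1.2) ∂F
        = ∫ z, centred F z q.1.2 * centred F z q.1.1
          * (centred F z q'.1.2 * centred F z q'.1.1) ∂F := by
      congr with z; ring
    rw [e2]
    simp
    ring

lemma memLp_inner_influence (hmom : Integrable (fun z => ‖z‖ ^ 8) F)
    (t : EuclideanSpace ℝ (ParamIdx p)) :
    MemLp (fun z => inner ℝ (influence F z) t) 4 F := by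
  simp only [PiLp.inner_apply]
  exact memLp_finsetSum _ fun q _ => by
    simpa using (memLp_influence hmom q).const_mul (t q)

lemma integral_inner_influence (hmom : Integrable (fun z => ‖z‖ ^ 8) F)
    (t : EuclideanSpace ℝ (ParamIdx p)) : ∫ z, inner ℝ (influence F z) t ∂F = 0 := by
  simp only [PiLp.inner_apply]
  rw [integral_finsetSum _ fun q _ => by
    simpa using ((memLp_influence hmom q).integrable (by norm_num)).const_mul (t q)]
  refine Finset.sum_eq_zero fun q _ => ?_
  simp [integral_const_mul, integral_influence hmom q]

lemma integral_inner_influence_sq (hmom : Integrable (fun z => ‖z‖ ^ 8) F)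
    (t : EuclideanSpace ℝ (ParamIdx p)) :
    ∫ z, inner ℝ (influence F z) t ^ 2 ∂F = t ⬝ᵥ asympCov F *ᵥ t := by
  have hint : ∀ i j, Integrable (fun z => t i * (influence F z i * influence F z j * t j)) F :=
    fun i j => ((((memLp_influence hmom i).mono_exponent (by norm_num)).integrable_mul
      (p := 2) (q := 2) ((memLp_influence hmom j).mono_exponent
        (by norm_num))).mul_const _).const_mul _
  have e : ∀ z, inner ℝ (influence F z) t ^ 2
      = ∑ i, ∑ j, t i * (influence F z i * influence F z j * t j) := fun z => by
    simp only [PiLp.inner_apply, sq, Finset.sum_mul_sum]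
    refine Finset.sum_congr rfl fun i _ => Finset.sum_congr rfl fun j _ => ?_
    simp
    ring
  simp_rw [e]
  rw [integral_finsetSum _ fun i _ => integrable_finsetSum _ fun j _ => hint i j]
  simp only [dotProduct, mulVec, Finset.mul_sum]
  refine Finset.sum_congr rfl fun i _ => ?_
  rw [integral_finsetSum _ fun j _ => hint i j]
  refine Finset.sum_congr rfl fun j _ => ?_
  rw [integral_const_mul, integral_mul_const, ← asympCov_apply hmom]

/-- The quadratic form at `x` is the second moment of the projection of the influence function on
`x`. The formula for the characteristic function of `multivariateGaussian` requires this property.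
-/
lemma posSemidef_asympCov (hmom : Integrable (fun z => ‖z‖ ^ 8) F) :
    (asympCov F).PosSemidef := by
  refine Matrix.PosSemidef.of_dotProduct_mulVec_nonneg ?_ fun x => ?_
  · ext i j
    simp [asympCov_apply hmom, mul_comm]
  · have := integral_inner_influence_sq hmom (WithLp.toLp 2 x)
    simp only [star_trivial]
    rw [← this]
    exact integral_nonneg fun z => sq_nonneg _

end AsymptoticCovariance

end Subbagging

end

noncomputable section

namespace Subbagging

/-! ### Deterministic bounds at the rate `r` -/

section Bounds

/-- A Lyapunov bound: each product splits into a variance factor `r² / (m k)` or `r² / N`, at most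
2, and a factor `r / (m k)` or `r / N`. The latter is small because its square is a variance factor
divided by `m k ≥ k` or by `N`. -/
lemma weighted_cube_le {r k m N : ℝ} (hr : 0 ≤ r) (hk : 0 < k) (hm : 1 ≤ m) (hN : 0 < N)
    (ha : r ^ 2 / (m * k) ≤ 2) (hb : r ^ 2 / N ≤ 2) :
    (r / (m * k)) ^ 3 * (N * (m * (k / N) + 3 * m ^ 2 * (k / N) ^ 2 + m ^ 3 * (k / N) ^ 3))
      ≤ 2 * √(2 / k) + 8 * √(2 / N) := by
  have hm0 : 0 < m := by linarith
  have e : (r / (m * k)) ^ 3 * (N * (m * (k / N) + 3 * m ^ 2 * (k / N) ^ 2 + m ^ 3 * (k / N) ^ 3))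
      = r ^ 2 / (m * k) * (r / (m * k)) + 3 * (r ^ 2 / (m * k) * (r / N))
        + r ^ 2 / N * (r / N) := by
    field_simp
  have h1 : r / (m * k) ≤ √(2 / k) := by
    refine Real.le_sqrt_of_sq_le ?_
    have e1 : (r / (m * k)) ^ 2 = r ^ 2 / (m * k) / (m * k) := by field_simp
    rw [e1]
    have : k ≤ m * k := le_mul_of_one_le_left hk.le hm
    gcongr
  have h2 : r / N ≤ √(2 / N) := by
    refine Real.le_sqrt_of_sq_le ?_
    have e1 : (r / N) ^ 2 = r ^ 2 / N / N := by field_simp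
    rw [e1]
    gcongr
  rw [e]
  have h3 : r ^ 2 / (m * k) * (r / (m * k)) ≤ 2 * √(2 / k) := by gcongr
  have h4 : r ^ 2 / (m * k) * (r / N) ≤ 2 * √(2 / N) := by gcongr
  have h5 : r ^ 2 / N * (r / N) ≤ 2 * √(2 / N) := by gcongr
  linarith

/-- The finite-population correction `1 - k / N` changes the variance by at most `2 k / N`; this is
one of the places where `k / N → 0` enters. -/
lemma abs_scaled_variance_sub_one_le {r k m N : ℝ} (hk : 0 < k) (hm : 0 < m)
    (hN : 0 < N) (ha : r ^ 2 / (m * k) ≤ 2) :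
    |r ^ 2 * ((1 - k / N) / (m * k) + 1 / N) - 1|
      ≤ |r ^ 2 / (m * k) + r ^ 2 / N - 1| + 2 * (k / N) := by
  have e : r ^ 2 * ((1 - k / N) / (m * k) + 1 / N) - 1
      = (r ^ 2 / (m * k) + r ^ 2 / N - 1) - r ^ 2 / (m * k) * (k / N) := by
    ring
  rw [e]
  refine (abs_sub _ _).trans (add_le_add le_rfl ?_)
  rw [abs_of_nonneg (by positivity)]
  gcongr

end Bounds

/-! ### Measurability, the leading term, and the second moment of the remainder -/

section CentralLimit

variable {Ω : Type*} [MeasurableSpace Ω] {P : Measure Ω}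
  {p : ℕ} {F : Measure (EuclideanSpace ℝ (Fin p))}
  {Z : ℕ → Ω → EuclideanSpace ℝ (Fin p)}

lemma measurable_stack {β : Type*} [MeasurableSpace β] {v : β → EuclideanSpace ℝ (Fin p)}
    {A : β → Matrix (Fin p) (Fin p) ℝ} (hv : ∀ a, Measurable fun x => v x a)
    (hA : ∀ a b, Measurable fun x => A x a b) : Measurable fun x => stack (v x) (A x) := by
  refine (WithLp.measurable_toLp _ _).comp (measurable_pi_lambda _ fun q => ?_)
  rcases q with a | q
  · exact hv a
  · exact hA _ _

/-- The tuples of subsamples form a countable discrete space, so joint measurability follows from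
measurability in the data for each fixed tuple. -/
lemma aemeasurable_comp_data_subsamples {β : Type*} [MeasurableSpace β] {m : ℕ}
    {f : (ℕ → EuclideanSpace ℝ (Fin p)) → (Fin m → Finset ℕ) → β}
    (hf : ∀ s, Measurable fun z => f z s) (hZ : ∀ i, AEMeasurable (Z i) P)
    {S : Fin m → Ω → Finset ℕ} (hS : ∀ j, Measurable (S j)) :
    AEMeasurable (fun ω => f (fun i => Z i ω) fun j => S j ω) P := by
  have h : Measurable (Function.uncurry f) := measurable_from_prod_countable_left hf
  exact h.comp_aemeasurable ((aemeasurable_pi_lambda _ hZ).prodMk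
    (measurable_pi_lambda _ hS).aemeasurable)

lemma measurable_subsampleMean (k : ℕ) (s : Finset ℕ) :
    Measurable fun z : ℕ → EuclideanSpace ℝ (Fin p) => subsampleMean k z s :=
  (Finset.measurable_sum s fun i _ => measurable_pi_apply i).const_smul (k : ℝ)⁻¹

lemma measurable_subsampleCov_apply (k : ℕ) (s : Finset ℕ) (a b : Fin p) :
    Measurable fun z : ℕ → EuclideanSpace ℝ (Fin p) => subsampleCov k z s a b := by
  have hc : ∀ (i : ℕ) (c : Fin p), Measurable fun z : ℕ → EuclideanSpace ℝ (Fin p) =>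
      (z i - subsampleMean k z s) c := fun i c =>
    (EuclideanSpace.proj (𝕜 := ℝ) c).measurable.comp
      ((measurable_pi_apply i).sub (measurable_subsampleMean k s))
  simp only [subsampleCov, Matrix.smul_apply, Matrix.sum_apply, vecMulVec_apply, smul_eq_mul]
  exact (Finset.measurable_sum s fun i _ => (hc i a).mul (hc i b)).const_mul _

lemma measurable_subbagEstimator (k m : ℕ) (s : Fin m → Finset ℕ) :
    Measurable fun z : ℕ → EuclideanSpace ℝ (Fin p) => subbagEstimator k m z s := by
  refine measurable_stack (v := fun z => subbagMean k m z s) (A := fun z => subbagCov k m z s)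
    (fun a => ?_) fun a b => ?_
  · exact (EuclideanSpace.proj (𝕜 := ℝ) a).measurable.comp
      ((Finset.measurable_sum _ fun j _ => measurable_subsampleMean k (s j)).const_smul (m : ℝ)⁻¹)
  · simp only [subbagCov, Matrix.smul_apply, Matrix.sum_apply, smul_eq_mul]
    exact (Finset.measurable_sum _ fun j _ =>
      measurable_subsampleCov_apply k (s j) a b).const_mul _

lemma measurable_stack_remainder (F : Measure (EuclideanSpace ℝ (Fin p))) (k N : ℕ) {m : ℕ}
    (s : Fin m → Finset ℕ) : Measurable fun z => stack 0 (remainder F k N z s) := by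
  refine measurable_stack (fun a => measurable_const) fun a b => ?_
  simp only [remainder, Matrix.of_apply]
  exact Finset.measurable_sum _ fun i _ =>
    (((measurable_centred F a).comp (measurable_pi_apply i.1)).mul
      ((measurable_centred F b).comp (measurable_pi_apply i.2))).const_mul _

/-- The leading term of the estimation error. -/
def leadingTerm (F : Measure (EuclideanSpace ℝ (Fin p))) (k N : ℕ) {m : ℕ}
    (z : ℕ → EuclideanSpace ℝ (Fin p)) (S : Fin m → Finset ℕ) :
    EuclideanSpace ℝ (ParamIdx p) :=
  ∑ i ∈ Finset.range N, (inclCount S i / (m * k)) • influence F (z i)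

lemma measurable_leadingTerm (F : Measure (EuclideanSpace ℝ (Fin p))) (k N : ℕ) {m : ℕ}
    (s : Fin m → Finset ℕ) : Measurable fun z => leadingTerm F k N z s :=
  Finset.measurable_sum _ fun i _ =>
    ((measurable_influence F).comp (measurable_pi_apply i)).const_smul
      (inclCount s i / ((m : ℝ) * k))

variable [IsProbabilityMeasure P] [IsProbabilityMeasure F] {k m N : ℕ} {S : Fin m → Ω → Finset ℕ}

/-- Each `vech` entry is, given the subsamples, a degenerate double sum whose weights are the pair
counts over `m k (k - 1)`. The mean of the squared weights comes from
`integral_sum_pairCount_sq_le`. -/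
lemma lintegral_norm_sq_remainder_le (hZlaw : ∀ i, HasLaw (Z i) F P) (hZ : iIndepFun Z P)
    (hmom : Integrable (fun z => ‖z‖ ^ 8) F)
    (hS : ∀ j, IsUniformSubset P k N (S j)) (hind : iIndepFun S P)
    (hZS : IndepFun (fun ω (i : Fin N) => Z i ω) (fun ω j => S j ω) P)
    (hk2 : 2 ≤ k) (hk : k ≤ N) (hm : 0 < m) :
    ∫⁻ ω, ENNReal.ofReal (‖stack 0 (remainder F k N (fun i => Z i ω) fun j => S j ω)‖ ^ 2) ∂P
      ≤ ENNReal.ofReal ((∑ q : VechIdx p, 2 * (covMat F q.1.2 q.1.2 * covMat F q.1.1 q.1.1)) *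
        (1 / (m * (k * (k - 1))) + 1 / (N * (N - 1)))) := by
  set w : ℕ × ℕ → (Fin m → Finset ℕ) → ℝ := fun i s =>
    (∑ j, incl (s j) i.1 * incl (s j) i.2) / (m * (k * (k - 1))) with hw
  have hk' : (2 : ℝ) ≤ k := by exact_mod_cast hk2
  have hN' : (2 : ℝ) ≤ N := by exact_mod_cast hk2.trans hk
  have hm0 : (0 : ℝ) < m := by exact_mod_cast hm
  have hk1 : (0 : ℝ) < k - 1 := by linarith
  have hN1 : (0 : ℝ) < N - 1 := by linarith
  have hwint : ∫ ω, ∑ i ∈ (Finset.range N).offDiag, w i (fun j => S j ω) ^ 2 ∂P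
      ≤ 1 / (m * (k * (k - 1))) + 1 / (N * (N - 1)) := by
    have h := integral_sum_pairCount_sq_le hS hind hk2 hk
    simp only [hw, div_pow, ← Finset.sum_div]
    rw [integral_div, div_le_iff₀ (by positivity)]
    refine h.trans (le_of_eq ?_)
    field_simp
  have hcov : ∀ a, covMat F a a = ∫ z, centred F z a ^ 2 ∂F := fun a => by
    simp_rw [sq]; rfl
  have hcov0 : ∀ a, 0 ≤ covMat F a a := fun a => by
    rw [hcov]; exact integral_nonneg fun z => sq_nonneg _
  have hnorm : ∀ ω, ENNReal.ofReal
      (‖stack 0 (remainder F k N (fun i => Z i ω) fun j => S j ω)‖ ^ 2)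
      = ∑ q : VechIdx p, ENNReal.ofReal ((∑ i ∈ (Finset.range N).offDiag,
        w i (fun j => S j ω) * (centred F (Z i.1 ω) q.1.2 * centred F (Z i.2 ω) q.1.1)) ^ 2) := by
    intro ω
    rw [EuclideanSpace.real_norm_sq_eq, Fintype.sum_sum_type,
      ← ENNReal.ofReal_sum_of_nonneg fun q _ => sq_nonneg _]
    congr 1
    simp [stack, vech, remainder, hw]
  have hmeas : ∀ q : VechIdx p, AEMeasurable (fun ω => ENNReal.ofReal
      ((∑ i ∈ (Finset.range N).offDiag, w i (fun j => S j ω) *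
        (centred F (Z i.1 ω) q.1.2 * centred F (Z i.2 ω) q.1.1)) ^ 2)) P := fun q => by
    refine ENNReal.measurable_ofReal.comp_aemeasurable (AEMeasurable.pow_const ?_ 2)
    refine Finset.aemeasurable_fun_sum _ fun i _ => AEMeasurable.mul ?_ (AEMeasurable.mul ?_ ?_)
    · exact ((Measurable.of_discrete (f := w i)).comp (measurable_subsamples hS)).aemeasurable
    · exact (measurable_centred F _).comp_aemeasurable (hZlaw _).aemeasurable
    · exact (measurable_centred F _).comp_aemeasurable (hZlaw _).aemeasurable
  simp_rw [hnorm]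
  rw [lintegral_finsetSum' _ fun q _ => hmeas q, Finset.sum_mul,
    ENNReal.ofReal_sum_of_nonneg fun q _ => mul_nonneg
      (mul_nonneg zero_le_two (mul_nonneg (hcov0 _) (hcov0 _))) (by positivity)]
  refine Finset.sum_le_sum fun q _ => ?_
  refine (lintegral_sq_sum_offDiag_random_le hZlaw hZ (measurable_centred F q.1.2)
    (measurable_centred F q.1.1) ((memLp_centred hmom _).mono_exponent (by norm_num))
    ((memLp_centred hmom _).mono_exponent (by norm_num)) (integral_centred hmom _)
    (integral_centred hmom _) N (measurable_subsamples hS).aemeasurable hZS w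
    (integrable_comp_subsamples hS hk fun s =>
      ∑ i ∈ (Finset.range N).offDiag, w i s ^ 2)).trans ?_
  refine ENNReal.ofReal_le_ofReal ?_
  rw [← hcov, ← hcov]
  exact mul_le_mul_of_nonneg_left hwint
    (mul_nonneg zero_le_two (mul_nonneg (hcov0 _) (hcov0 _)))

end CentralLimit

/-! ### Passage to the limit -/

section Limits

variable {Ω : Type*} [MeasurableSpace Ω] {P : Measure Ω} [IsProbabilityMeasure P]
  {p : ℕ} {F : Measure (EuclideanSpace ℝ (Fin p))} [IsProbabilityMeasure F]
  {Z : ℕ → Ω → EuclideanSpace ℝ (Fin p)} {k m : ℕ → ℕ} {S : (N : ℕ) → Fin (m N) → Ω → Finset ℕ}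
  {r : ℕ → ℝ}

lemma eventually_le_of_tendsto_div (hk : Tendsto (fun N => (k N : ℝ) / (N : ℝ)) atTop (𝓝 0)) :
    ∀ᶠ N in atTop, k N ≤ N := by
  filter_upwards [hk.eventually (gt_mem_nhds one_pos), eventually_gt_atTop 0] with N h1 h2
  rw [div_lt_one (by exact_mod_cast h2)] at h1
  exact_mod_cast h1.le

lemma eventually_scale_le
    (hr : Tendsto (fun N => r N ^ 2 / (m N * k N) + r N ^ 2 / N) atTop (𝓝 1)) :
    ∀ᶠ N in atTop, r N ^ 2 / (m N * k N) ≤ 2 ∧ r N ^ 2 / N ≤ 2 := by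
  filter_upwards [hr.eventually (gt_mem_nhds one_lt_two)] with N h
  have h1 : 0 ≤ r N ^ 2 / (m N * k N) := by positivity
  have h2 : 0 ≤ r N ^ 2 / N := by positivity
  constructor <;> linarith

/-- The characteristic function at `t` sees only the projections of the influence functions on `t`,
which are real, centred, and of variance `q = t ⬝ᵥ asympCov F *ᵥ t`. The quantitative
one-dimensional bound therefore suffices. -/
lemma tendsto_charFun_leadingTerm (hZlaw : ∀ i, HasLaw (Z i) F P) (hZ : iIndepFun Z P)
    (hmom : Integrable (fun z => ‖z‖ ^ 8) F)
    (hS : ∀ N j, IsUniformSubset P (k N) N (S N j)) (hind : ∀ N, iIndepFun (S N) P)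
    (hZS : ∀ N, IndepFun (fun ω (i : Fin N) => Z i ω) (fun ω j => S N j ω) P)
    (hk : Tendsto k atTop atTop)
    (hkN : Tendsto (fun N => (k N : ℝ) / (N : ℝ)) atTop (𝓝 0))
    (hm : ∀ᶠ N in atTop, 0 < m N) (hr0 : ∀ N, 0 ≤ r N)
    (hr : Tendsto (fun N => r N ^ 2 / (m N * k N) + r N ^ 2 / N) atTop (𝓝 1))
    (t : EuclideanSpace ℝ (ParamIdx p)) :
    Tendsto (fun N => charFun (P.map fun ω =>
        r N • leadingTerm F (k N) N (fun i => Z i ω) fun j => S N j ω) t) atTop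
      (𝓝 (charFun (multivariateGaussian 0 (asympCov F)) t)) := by
  set Y : EuclideanSpace ℝ (Fin p) → ℝ := fun z => inner ℝ (influence F z) t with hYdef
  set q : ℝ := t ⬝ᵥ asympCov F *ᵥ t with hqdef
  have hYm : Measurable Y := (measurable_influence F).inner measurable_const
  have hYL : MemLp Y 3 F := (memLp_inner_influence hmom t).mono_exponent (by norm_num)
  have hq : ∫ z, Y z ^ 2 ∂F = q := integral_inner_influence_sq hmom t
  have hq0 : 0 ≤ q := by rw [← hq]; exact integral_nonneg fun z => sq_nonneg _
  have : IsProbabilityMeasure (F.map Y) := Measure.isProbabilityMeasure_map hYm.aemeasurable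
  obtain ⟨C, hC0, hC⟩ := exists_norm_charFun_sub_exp_le (F.map Y)
    ((memLp_map_measure_iff (by fun_prop) hYm.aemeasurable).2 hYL)
    (by rw [integral_map hYm.aemeasurable (by fun_prop)]; exact integral_inner_influence hmom t)
  rw [integral_map hYm.aemeasurable (by fun_prop), hq] at hC
  have hlim : charFun (multivariateGaussian 0 (asympCov F)) t = (Real.exp (-(q / 2)) : ℝ) := by
    rw [charFun_multivariateGaussian (posSemidef_asympCov hmom)]
    simp [hqdef]
  have hchar : ∀ N, charFun (P.map fun ω =>
        r N • leadingTerm F (k N) N (fun i => Z i ω) fun j => S N j ω) t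
      = ∫ ω, Complex.exp ((∑ i ∈ Finset.range N, r N * (inclCount (fun j => S N j ω) i
          / (m N * k N)) * Y (Z i ω) : ℝ) * Complex.I) ∂P := fun N => by
    rw [charFun_apply, integral_map (aemeasurable_comp_data_subsamples
      (f := fun z s => r N • leadingTerm F (k N) N z s)
      (fun s => (measurable_leadingTerm F (k N) N s).const_smul (r N))
      (fun i => (hZlaw i).aemeasurable) fun j => (hS N j).measurable) (by fun_prop)]
    congr with ω
    congr 3
    simp only [leadingTerm, real_inner_smul_left, sum_inner, Finset.mul_sum, hYdef, mul_assoc]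
  rw [hlim, tendsto_iff_norm_sub_tendsto_zero]
  simp_rw [hchar]
  have hkr : Tendsto (fun N => (k N : ℝ)) atTop atTop := tendsto_natCast_atTop_atTop.comp hk
  have hNr : Tendsto (fun N : ℕ => (N : ℝ)) atTop atTop := tendsto_natCast_atTop_atTop
  have hsqrt : ∀ {u : ℕ → ℝ}, Tendsto u atTop atTop →
      Tendsto (fun N => √(2 / u N)) atTop (𝓝 0) := fun hu => by
    have := (Real.continuous_sqrt.tendsto 0).comp (hu.const_div_atTop 2)
    rwa [Real.sqrt_zero] at this
  have hbound : Tendsto (fun N : ℕ => C * (2 * √(2 / (k N : ℝ)) + 8 * √(2 / (N : ℝ)))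
      + q / 2 * ((|r N ^ 2 / (m N * k N) + r N ^ 2 / N - 1| + 2 * ((k N : ℝ) / N))
        + 4 / √N)) atTop (𝓝 0) := by
    have h1 := (hr.sub_const 1).abs
    have h2 : Tendsto (fun N : ℕ => 4 / √(N : ℝ)) atTop (𝓝 0) :=
      (Real.tendsto_sqrt_atTop.comp hNr).const_div_atTop 4
    have h3 := ((((hsqrt hkr).const_mul 2).add ((hsqrt hNr).const_mul 8)).const_mul C).add
      (((h1.add (hkN.const_mul 2)).add h2).const_mul (q / 2))
    simpa using h3
  refine squeeze_zero' (.of_forall fun N => norm_nonneg _) ?_ hbound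
  filter_upwards [hk.eventually_ge_atTop 2, eventually_le_of_tendsto_div hkN, hm,
    eventually_scale_le hr] with N h1 h2 h3 ⟨h4, h5⟩
  have hm1 : (1 : ℝ) ≤ m N := by exact_mod_cast h3
  have hm0 : (0 : ℝ) < m N := by linarith
  have hk0 : (0 : ℝ) < k N := by exact_mod_cast (by omega : 0 < k N)
  have hN0 : (0 : ℝ) < N := by exact_mod_cast (by omega : 0 < N)
  refine (norm_integral_exp_sum_inclCount_sub_le hZlaw hZ hYm (hS N) (hind N) (hZS N) h1 h2 h3
    hC0 hq0 hC (hr0 N)).trans ?_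
  gcongr
  · exact weighted_cube_le (hr0 N) hk0 hm1 hN0 h4 h5
  · exact abs_scaled_variance_sub_one_le hk0 hm0 hN0 h4
  · have e : r N ^ 2 / (m N * k N : ℝ) ^ 2 * (2 * (m N * k N) / √N)
        = 2 * (r N ^ 2 / (m N * k N)) / √N := by field_simp
    rw [e]
    gcongr
    linarith

/-- Markov's inequality for the squared norm. The second moment times `r²` is at most a constant
times `2 / (k - 1) + 2 / (N - 1)`, since it has one factor of `k - 1` or `N - 1` more in the
denominator than the bounded quantities `r² / (m k)` and `r² / N`. -/
lemma tendstoInMeasure_remainder (hZlaw : ∀ i, HasLaw (Z i) F P) (hZ : iIndepFun Z P)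
    (hmom : Integrable (fun z => ‖z‖ ^ 8) F)
    (hS : ∀ N j, IsUniformSubset P (k N) N (S N j)) (hind : ∀ N, iIndepFun (S N) P)
    (hZS : ∀ N, IndepFun (fun ω (i : Fin N) => Z i ω) (fun ω j => S N j ω) P)
    (hk : Tendsto k atTop atTop)
    (hkN : Tendsto (fun N => (k N : ℝ) / (N : ℝ)) atTop (𝓝 0))
    (hm : ∀ᶠ N in atTop, 0 < m N)
    (hr : Tendsto (fun N => r N ^ 2 / (m N * k N) + r N ^ 2 / N) atTop (𝓝 1))
    {ε : ℝ} (hε : 0 < ε) :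
    Tendsto (fun N => P {ω | ε ≤
      ‖r N • stack 0 (remainder F (k N) N (fun i => Z i ω) fun j => S N j ω)‖}) atTop (𝓝 0) := by
  set K : ℝ := ∑ q : VechIdx p, 2 * (covMat F q.1.2 q.1.2 * covMat F q.1.1 q.1.1) with hK
  have hcov0 : ∀ a, 0 ≤ covMat F a a := fun a => integral_nonneg fun z => mul_self_nonneg _
  have hK0 : 0 ≤ K := Finset.sum_nonneg fun q _ =>
    mul_nonneg zero_le_two (mul_nonneg (hcov0 _) (hcov0 _))
  have hkr : Tendsto (fun N => (k N : ℝ)) atTop atTop := tendsto_natCast_atTop_atTop.comp hk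
  have hNr : Tendsto (fun N : ℕ => (N : ℝ)) atTop atTop := tendsto_natCast_atTop_atTop
  have hbound : Tendsto (fun N : ℕ => ENNReal.ofReal (K * (2 / ((k N : ℝ) - 1) + 2 / ((N : ℝ) - 1)))
      / ENNReal.ofReal (ε ^ 2)) atTop (𝓝 0) := by
    have h1 := ((tendsto_atTop_add_const_right _ (-1) hkr).const_div_atTop 2).add
      ((tendsto_atTop_add_const_right _ (-1) hNr).const_div_atTop 2)
    have h2 := ENNReal.tendsto_ofReal (h1.const_mul K)
    have h3 := ENNReal.Tendsto.div_const h2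
      (Or.inr (ENNReal.ofReal_pos.2 (by positivity : 0 < ε ^ 2)).ne')
    simpa [sub_eq_add_neg] using h3
  refine tendsto_of_tendsto_of_tendsto_of_le_of_le' tendsto_const_nhds hbound
    (.of_forall fun N => zero_le) ?_
  filter_upwards [hk.eventually_ge_atTop 2, eventually_le_of_tendsto_div hkN, hm,
    eventually_scale_le hr] with N h1 h2 h3 ⟨h4, h5⟩
  have hm0 : (0 : ℝ) < m N := by exact_mod_cast h3
  have hk2 : (2 : ℝ) ≤ k N := by exact_mod_cast h1
  have hN2 : (2 : ℝ) ≤ N := by exact_mod_cast h1.trans h2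
  have hk1 : (0 : ℝ) < k N - 1 := by linarith
  have hN1 : (0 : ℝ) < N - 1 := by linarith
  set W : Ω → EuclideanSpace ℝ (ParamIdx p) := fun ω =>
    stack 0 (remainder F (k N) N (fun i => Z i ω) fun j => S N j ω) with hW
  have hle := lintegral_norm_sq_remainder_le hZlaw hZ hmom (hS N) (hind N) (hZS N) h1 h2 h3
  rw [← hK] at hle
  have hset : {ω | ε ≤ ‖r N • W ω‖}
      ⊆ {ω | ENNReal.ofReal (ε ^ 2) ≤ ENNReal.ofReal (r N ^ 2 * ‖W ω‖ ^ 2)} := fun ω hω => by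
    refine ENNReal.ofReal_le_ofReal ?_
    have h6 : ε ^ 2 ≤ ‖r N • W ω‖ ^ 2 := pow_le_pow_left₀ hε.le hω 2
    rwa [norm_smul, mul_pow, Real.norm_eq_abs, sq_abs] at h6
  have hεne : ENNReal.ofReal (ε ^ 2) ≠ 0 := (ENNReal.ofReal_pos.2 (by positivity)).ne'
  refine (measure_mono hset).trans ?_
  refine (ENNReal.le_div_iff_mul_le (Or.inl hεne) (Or.inl ENNReal.ofReal_ne_top)).2 ?_
  rw [mul_comm]
  refine (mul_meas_ge_le_lintegral₀ ?_ _).trans ?_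
  · refine ENNReal.measurable_ofReal.comp_aemeasurable (AEMeasurable.const_mul ?_ _)
    exact (aemeasurable_comp_data_subsamples (fun s => measurable_stack_remainder F (k N) N s)
      (fun i => (hZlaw i).aemeasurable) fun j => (hS N j).measurable).norm.pow_const 2
  · calc ∫⁻ ω, ENNReal.ofReal (r N ^ 2 * ‖W ω‖ ^ 2) ∂P
        = ENNReal.ofReal (r N ^ 2) * ∫⁻ ω, ENNReal.ofReal (‖W ω‖ ^ 2) ∂P := by
          rw [← lintegral_const_mul' _ _ ENNReal.ofReal_ne_top]
          simp_rw [ENNReal.ofReal_mul (sq_nonneg (r N))]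
      _ ≤ ENNReal.ofReal (r N ^ 2) * ENNReal.ofReal (K *
            (1 / (m N * (k N * (k N - 1))) + 1 / (N * (N - 1)))) := by gcongr
      _ ≤ _ := by
          rw [← ENNReal.ofReal_mul (sq_nonneg _)]
          refine ENNReal.ofReal_le_ofReal ?_
          have e : r N ^ 2 * (K * (1 / (m N * (k N * (k N - 1))) + 1 / (N * (N - 1))))
              = K * (r N ^ 2 / (m N * k N) / (k N - 1) + r N ^ 2 / N / (N - 1)) := by
            field_simp
          rw [e]
          gcongr

/-- Central limit theorem for the subbagging estimator at a general rate `r`. -/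
theorem tendstoInDistribution_smul_subbagEstimator_sub
    (hZlaw : ∀ i, HasLaw (Z i) F P) (hZ : iIndepFun Z P)
    (hmom : Integrable (fun z => ‖z‖ ^ 8) F)
    (hS : ∀ N j, IsUniformSubset P (k N) N (S N j)) (hind : ∀ N, iIndepFun (S N) P)
    (hZS : ∀ N, IndepFun (fun ω (i : Fin N) => Z i ω) (fun ω j => S N j ω) P)
    (hk : Tendsto k atTop atTop)
    (hkN : Tendsto (fun N => (k N : ℝ) / (N : ℝ)) atTop (𝓝 0))
    (hm : ∀ᶠ N in atTop, 0 < m N) (hr0 : ∀ N, 0 ≤ r N)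
    (hr : Tendsto (fun N => r N ^ 2 / (m N * k N) + r N ^ 2 / N) atTop (𝓝 1)) :
    TendstoInDistribution
      (fun (N : ℕ) (ω : Ω) => r N •
        (subbagEstimator (k N) (m N) (fun i => Z i ω) (fun j => S N j ω) - trueParam F))
      atTop id (fun _ => P) (multivariateGaussian 0 (asympCov F)) := by
  have hXm : ∀ N, AEMeasurable (fun ω =>
      r N • leadingTerm F (k N) N (fun i => Z i ω) fun j => S N j ω) P := fun N =>
    aemeasurable_comp_data_subsamples (f := fun z s => r N • leadingTerm F (k N) N z s)
      (fun s => (measurable_leadingTerm F (k N) N s).const_smul (r N))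
      (fun i => (hZlaw i).aemeasurable) fun j => (hS N j).measurable
  have hXd : TendstoInDistribution (fun (N : ℕ) (ω : Ω) =>
      r N • leadingTerm F (k N) N (fun i => Z i ω) fun j => S N j ω)
      atTop id (fun _ => P) (multivariateGaussian 0 (asympCov F)) := by
    refine ⟨hXm, aemeasurable_id, ProbabilityMeasure.tendsto_iff_tendsto_charFun.2 fun t => ?_⟩
    have := tendsto_charFun_leadingTerm hZlaw hZ hmom hS hind hZS hk hkN hm hr0 hr t
    simpa using this
  -- Slutsky: the scaled error and the scaled leading term differ by the scaled remainder. The exact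
  -- decomposition holds almost surely, namely when every subsample is a subset of `range N` of size
  -- `k N`.
  refine tendstoInDistribution_of_tendstoInMeasure_sub _ _ hXd ?_ fun N =>
    aemeasurable_comp_data_subsamples
      (f := fun z s => r N • (subbagEstimator (k N) (m N) z s - trueParam F))
      (fun s => ((measurable_subbagEstimator (k N) (m N) s).sub_const _).const_smul (r N))
      (fun i => (hZlaw i).aemeasurable) fun j => (hS N j).measurable
  rw [tendstoInMeasure_iff_norm]
  intro ε hε
  refine (tendstoInMeasure_remainder hZlaw hZ hmom hS hind hZS hk hkN hm hr hε).congr' ?_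
  filter_upwards [hk.eventually_ge_atTop 2, eventually_le_of_tendsto_div hkN, hm] with N h1 h2 h3
  refine measure_congr ?_
  filter_upwards [ae_forall_mem (hS N) h2] with ω hω
  have h := subbagEstimator_sub_trueParam F h1 h3.ne' (fun i => Z i ω) (Fintype.mem_piFinset.1 hω)
  refine congrArg (ε ≤ ·) ?_
  simp only [Pi.sub_apply, Pi.zero_apply, sub_zero]
  rw [h, ← smul_sub, leadingTerm, sub_sub_cancel_left, smul_neg, norm_neg]

end Limits

end Subbagging

end

/-! ### The two regimes -/

theorem theorem3 {Ω : Type*} [MeasurableSpace Ω] (P : Measure Ω) [IsProbabilityMeasure P]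
    (p : ℕ)
    -- the law of `Z`, and the iid data (`Z 0, …, Z (N - 1)` are the first `N` observations)
    (F : Measure (EuclideanSpace ℝ (Fin p))) [IsProbabilityMeasure F]
    (Z : ℕ → Ω → EuclideanSpace ℝ (Fin p))
    (hZlaw : ∀ i, HasLaw (Z i) F P) (hZindep : iIndepFun Z P)
    -- for every `N`: `m N` subsamples, iid uniform on the subsets of size `k N`, drawn
    -- independently of the data
    (k m : ℕ → ℕ) (S : (N : ℕ) → Fin (m N) → Ω → Finset ℕ)
    (hSmeas : ∀ N j, Measurable (S N j))
    (hSunif : ∀ N j, ∀ s ∈ Finset.powersetCard (k N) (Finset.range N),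
      P {ω | S N j ω = s} = (N.choose (k N) : ℝ≥0∞)⁻¹)
    (hSindep : ∀ N, iIndepFun (S N) P)
    (hZS : ∀ N, IndepFun (fun ω (i : Fin N) => Z i ω) (fun ω j => S N j ω) P)
    -- the common conditions
    (hk : Tendsto k atTop atTop)
    (hkN : Tendsto (fun N => (k N : ℝ) / (N : ℝ)) atTop (𝓝 0))
    (hmom : Integrable (fun z => ‖z‖ ^ 8) F)
    (hsing : (Subbagging.asympCov F).det ≠ 0) :
    (∀ α : ℝ≥0∞, 0 < α →
      Tendsto (fun N => ((k N * m N : ℕ) : ℝ≥0∞) / (N : ℝ≥0∞)) atTop (𝓝 α) →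
      TendstoInDistribution
        (fun (N : ℕ) (ω : Ω) => (√((1 + α⁻¹).toReal / (N : ℝ)))⁻¹ •
          (Subbagging.subbagEstimator (k N) (m N) (fun i => Z i ω) (fun j => S N j ω)
            - Subbagging.trueParam F))
        atTop id (fun _ => P) (multivariateGaussian 0 (Subbagging.asympCov F))) ∧
    (Tendsto (fun N => ((k N : ℝ) * (m N : ℝ)) / (N : ℝ)) atTop (𝓝 0) →
      Tendsto m atTop atTop →
      TendstoInDistribution
        (fun (N : ℕ) (ω : Ω) => (√(1 / ((k N : ℝ) * (m N : ℝ))))⁻¹ •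
          (Subbagging.subbagEstimator (k N) (m N) (fun i => Z i ω) (fun j => S N j ω)
            - Subbagging.trueParam F))
        atTop id (fun _ => P) (multivariateGaussian 0 (Subbagging.asympCov F))) := by
  have hS : ∀ N j, Subbagging.IsUniformSubset P (k N) N (S N j) :=
    fun N j => ⟨hSmeas N j, hSunif N j⟩
  constructor
  · intro α hα hlim
    have hαinv : α⁻¹ ≠ ⊤ := ENNReal.inv_ne_top.2 hα.ne'
    set c : ℝ := (1 + α⁻¹).toReal with hc
    have hc' : c = 1 + (α⁻¹).toReal := by
      rw [hc, ENNReal.toReal_add ENNReal.one_ne_top hαinv]; simp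
    have hc0 : 0 < c := by rw [hc']; positivity
    -- No positivity of `m` is assumed, but `m N = 0` would make the ratio 0, which is eventually
    -- excluded by its positive limit.
    have hm : ∀ᶠ N in atTop, 0 < m N := by
      filter_upwards [hlim.eventually (lt_mem_nhds hα)] with N hN
      refine Nat.pos_of_ne_zero fun h => ?_
      simp [h] at hN
    refine Subbagging.tendstoInDistribution_smul_subbagEstimator_sub hZlaw hZindep hmom hS hSindep
      hZS hk hkN hm (fun N => by positivity) ?_
    have hinv : Tendsto (fun N : ℕ => (N : ℝ) / (m N * k N)) atTop (𝓝 (α⁻¹).toReal) := by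
      have h1 := (ENNReal.tendsto_toReal hαinv).comp (tendsto_inv_iff.2 hlim)
      refine h1.congr fun N => ?_
      simp [ENNReal.toReal_inv, ENNReal.toReal_div, mul_comm]
    -- This is `r² / (m k) + r² / N` for `r² = N / c`. Its limit is `(1/α + 1) / c = 1`, including
    -- `α = ∞`, where `α⁻¹ = 0`.
    have h2 : Tendsto (fun N : ℕ => ((N : ℝ) / (m N * k N) + 1) / c) atTop (𝓝 1) := by
      have := (hinv.add_const 1).div_const c
      rwa [add_comm (α⁻¹).toReal, ← hc', div_self hc0.ne'] at this
    refine h2.congr' ?_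
    filter_upwards [eventually_gt_atTop 0] with N hN
    have hN0 : (0 : ℝ) < N := by exact_mod_cast hN
    rw [inv_pow, Real.sq_sqrt (by positivity), inv_div]
    field_simp
  · intro hlim hmt
    have hm : ∀ᶠ N in atTop, 0 < m N := hmt.eventually_gt_atTop 0
    refine Subbagging.tendstoInDistribution_smul_subbagEstimator_sub hZlaw hZindep hmom hS hSindep
      hZS hk hkN hm (fun N => by positivity) ?_
    -- For `r² = k m` the normalisation `r² / (m k) + r² / N` equals `1 + k m / N`.
    have h2 := hlim.const_add 1
    rw [add_zero] at h2
    refine h2.congr' ?_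
    filter_upwards [hm, hk.eventually_gt_atTop 0] with N h3 h4
    have h3' : (0 : ℝ) < m N := by exact_mod_cast h3
    have h4' : (0 : ℝ) < k N := by exact_mod_cast h4
    rw [inv_pow, Real.sq_sqrt (by positivity), one_div, inv_inv]
    field_simp
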